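/- For $r>0$ let $B_r=\{x\in\mathbb R^n:|x|<r\}$ and set $Q_3=[-4,0]\times B_3$, $Q_2=[-4,0]\times B_2$, $\overline Q_2=[-2,0]\times B_2$. Let $n\ge 1$ be an integer and let $\Lambda>0$, $p>2$, $m>1+\frac{\max(n,2)}{p}$ and $\delta_0>0$ be real numbers. Then there is a constant $\mu_0>0$, depending only on $\Lambda,p,m,\delta_0$ and $n$, with the following property. Let $A\in L^\infty(Q_3;\mathbb R^{n\times n})$ with $\|A\|_{L^\infty(Q_3)}\le\Lambda$ (where matrices carry the Euclidean operator norm; $A$ need not be symmetric or positive), let $f\in L^m(Q_3)$ with $\|f\|_{L^m(Q_3)}\le\Lambda$, and let $u\in L^p(Q_3)$ have a weak spatial gradient $\nabla u\in L^p(Q_3;\mathbb R^n)$ and satisfy $$\partial_t u+\Lambda^{-1}|\nabla u|^p-\operatorname{div}(A\nabla u)\le f$$ in the sense of distributions on $(-4,0)\times B_3$, that is, $$\iint\Big(-u\,\partial_t\varphi+\Lambda^{-1}|\nabla u|^p\varphi+(A\nabla u)\cdot\nabla\varphi\Big)\,dx\,dt\le\iint f\varphi\,dx\,dt\qquad\text{for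 all }0\le\varphi\in C_c^\infty((-4,0)\times B_3).$$ If $u\le 2$ almost everywhere on $Q_3$, $$|\{u\le 0\}\cap Q_2|\ge\frac{|Q_2|}{2}\qquad\text{and}\qquad|\{u\ge 1\}\cap\overline Q_2|\ge\delta_0,$$ then $$|\{0<u<1\}\cap Q_2|\ge\mu_0 .$$ -/

import Mathlib

open MeasureTheory Set

namespace HJ

/-- The space `ℝⁿ` with its Euclidean norm; space-time points are `z = (t, x) : ℝ × Space n`. -/
abbrev Space (n : ℕ) : Type := EuclideanSpace ℝ (Fin n)

/-- The cylinder `[-T, 0] × B_r`, where `B_r` is the open ball of radius `r` centred at `0`. -/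
def cylinder (n : ℕ) (T r : ℝ) : Set (ℝ × Space n) :=
  Icc (-T) 0 ×ˢ Metric.ball (0 : Space n) r

/-- The open cylinder `(-T, 0) × B_r`, on which distributions are tested. -/
def openCylinder (n : ℕ) (T r : ℝ) : Set (ℝ × Space n) :=
  Ioo (-T) 0 ×ˢ Metric.ball (0 : Space n) r

/-- `φ ∈ C_c^∞(U)`. -/
structure IsTestFunction {n : ℕ} (U : Set (ℝ × Space n)) (φ : ℝ × Space n → ℝ) : Prop where
  smooth : ContDiff ℝ ((⊤ : ℕ∞) : WithTop ℕ∞) φ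
  compact : HasCompactSupport φ
  support : tsupport φ ⊆ U

/-- The time derivative `∂ₜ φ (t, x)`. -/
noncomputable def timeDeriv {n : ℕ} (φ : ℝ × Space n → ℝ) (z : ℝ × Space n) : ℝ :=
  fderiv ℝ φ z (1, 0)

/-- The spatial directional derivative `∇ₓ φ (t, x) · v`. -/
noncomputable def spaceDeriv {n : ℕ} (φ : ℝ × Space n → ℝ) (z : ℝ × Space n) (v : Space n) : ℝ :=
  fderiv ℝ φ z (0, v)

/-- `g` is the weak spatial gradient `∇u` of `u` on the open set `U`. -/
def IsWeakGradient {n : ℕ} (U : Set (ℝ × Space n)) (u : ℝ × Space n → ℝ)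
    (g : ℝ × Space n → Space n) : Prop :=
  ∀ φ : ℝ × Space n → ℝ, IsTestFunction U φ → ∀ v : Space n,
    ∫ z in U, u z * spaceDeriv φ z v = -∫ z in U, inner ℝ (g z) v * φ z

/-- `∂ₜ u + Λ⁻¹ |∇u|ᵖ - div (A ∇u) ≤ f` on `U` in the sense of distributions, where `g = ∇u`:
both sides are paired with an arbitrary nonnegative test function, and the derivatives `∂ₜ` and
`div` are moved onto it. -/
def IsSubsolution {n : ℕ} (U : Set (ℝ × Space n)) (Λ p : ℝ)
    (A : ℝ × Space n → Matrix (Fin n) (Fin n) ℝ) (f u : ℝ × Space n → ℝ)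
    (g : ℝ × Space n → Space n) : Prop :=
  ∀ φ : ℝ × Space n → ℝ, IsTestFunction U φ → (∀ z, 0 ≤ φ z) →
    ∫ z in U, (-(u z * timeDeriv φ z) + Λ⁻¹ * ‖g z‖ ^ p * φ z
        + spaceDeriv φ z (Matrix.toEuclideanCLM (n := Fin n) (𝕜 := ℝ) (A z) (g z)))
      ≤ ∫ z in U, f z * φ z

end HJ

/-! Suppose the intermediate set is tiny. The gradient term does all the work: since p > 2 it
dominates the second-order term, whatever the sign of A. Test with β'(u)ξ², where β(r) = r₊^(k+3).
The diffusion produces at most Λβ''(u)|∇u|²ξ² and a cross term with ∇ξ, and for k large both are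
absorbed into β'(u)|∇u|^p ξ² up to a constant (`exists_absorb`). The resulting `exists_energy`
bounds the dissipation ∬β'(u)|∇u|^p ξ² and gives a one-sided modulus of continuity: the mass ∫β(u)ξ²
may drop suddenly but cannot rise quickly, because a bound on f in L^m with m > 1 makes ∬|f| small
over short time intervals.

In space, a De Giorgi isoperimetric inequality on each time slice bounds |{u ≤ 0}|·|{u ≥ 1}| by a
gradient integral over {0 < u < 1}. Young's inequality splits this into a small multiple of the
dissipation and a large multiple of the measure of the intermediate set, so the product is small on
average in time: at most times one of the two sets is almost empty.

In time, the hypotheses supply a slice where {u ≥ 1} is almost empty, so the mass is near 0, and a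
later one where {u ≤ 0} is almost empty, so the mass is at least about |B_1|. As exceptional times
have small measure, two such slices can be found close together, and the mass would rise too fast
(`no_transition`).

This is carried out for C¹ functions and transferred by mollification. The mollified flux is not A
applied to the mollified gradient, so `IsClassicalSubsolution` retains only a function G, here the
mollified |∇u|, that bounds both gradient and flux; Jensen's inequality preserves the term with the
p-th power. The measure hypotheses of `exists_intermediate_measure` have slack κ, and replacing u by
3u - 1 tolerates errors below 1/3 off a small set, so a single mollification is enough. -/

namespace HJ

/-! ### Powers of the positive part and a C¹ step function -/

/-- The positive part to the power `N`. -/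
noncomputable def posPow (N : ℕ) (r : ℝ) : ℝ := (max r 0) ^ N

lemma posPow_nonneg (N : ℕ) (r : ℝ) : 0 ≤ posPow N r := pow_nonneg (le_max_right _ _) _

lemma posPow_of_nonpos {N : ℕ} (hN : N ≠ 0) {r : ℝ} (hr : r ≤ 0) : posPow N r = 0 := by
  simp [posPow, max_eq_right hr, hN]

lemma posPow_of_nonneg (N : ℕ) {r : ℝ} (hr : 0 ≤ r) : posPow N r = r ^ N := by
  simp [posPow, max_eq_left hr]

lemma posPow_mono (N : ℕ) : Monotone (posPow N) := fun _ _ h =>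
  pow_le_pow_left₀ (le_max_right _ _) (max_le_max_right _ h) _

@[fun_prop]
lemma continuous_posPow (N : ℕ) : Continuous (posPow N) := by
  unfold posPow; fun_prop

lemma hasDerivAt_posPow (N : ℕ) (r : ℝ) :
    HasDerivAt (posPow (N + 2)) ((N + 2) * posPow (N + 1) r) r := by
  rcases lt_trichotomy r 0 with hr | rfl | hr
  · rw [posPow_of_nonpos (by omega) hr.le, mul_zero]
    refine (hasDerivAt_const r (0 : ℝ)).congr_of_eventuallyEq ?_
    filter_upwards [Iio_mem_nhds hr] with s hs
    exact posPow_of_nonpos (by omega) (le_of_lt hs)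
  · rw [posPow_of_nonpos (by omega) le_rfl, mul_zero, hasDerivAt_iff_isLittleO]
    have h1 : (fun x : ℝ => x ^ (N + 2)) =o[nhds 0] fun x : ℝ => x := by
      simpa using (Asymptotics.isLittleO_pow_pow (𝕜 := ℝ) (show 1 < N + 2 by omega))
    refine Asymptotics.IsBigO.trans_isLittleO (g := fun x : ℝ => x ^ (N + 2)) ?_ (by simpa using h1)
    refine Asymptotics.IsBigO.of_bound 1 (Filter.Eventually.of_forall fun x => ?_)
    rw [posPow_of_nonpos (by omega) le_rfl]
    simp only [posPow, sub_zero, smul_zero, norm_pow, one_mul, Real.norm_eq_abs]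
    refine pow_le_pow_left₀ (abs_nonneg _) ?_ _
    rw [abs_of_nonneg (le_max_right _ _)]
    exact max_le (le_abs_self _) (abs_nonneg _)
  · rw [posPow_of_nonneg _ hr.le]
    have := hasDerivAt_pow (N + 2) r
    push_cast at this
    refine (this.congr_of_eventuallyEq ?_)
    filter_upwards [Ioi_mem_nhds hr] with s hs
    exact posPow_of_nonneg _ (le_of_lt hs)

/-- A function which is `0` on `(-∞, 0]` and `1` on `[1, ∞)`. -/
noncomputable def step (k : ℕ) (r : ℝ) : ℝ := 1 - posPow 2 (1 - posPow (k + 3) r)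

/-- The derivative of `step`. -/
noncomputable def stepDeriv (k : ℕ) (r : ℝ) : ℝ :=
  2 * posPow 1 (1 - posPow (k + 3) r) * ((k + 3) * posPow (k + 2) r)

lemma hasDerivAt_step (k : ℕ) (r : ℝ) : HasDerivAt (step k) (stepDeriv k r) r := by
  have h1 := (hasDerivAt_posPow (k + 1) r)
  have h2 := hasDerivAt_posPow 0 (1 - posPow (k + 3) r)
  have h3 := (HasDerivAt.comp r h2 (h1.const_sub 1)).const_sub 1
  refine h3.congr_deriv ?_
  simp only [stepDeriv]; push_cast; ring

@[fun_prop]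
lemma continuous_stepDeriv (k : ℕ) : Continuous (stepDeriv k) := by
  unfold stepDeriv; fun_prop

lemma step_of_nonpos (k : ℕ) {r : ℝ} (hr : r ≤ 0) : step k r = 0 := by
  rw [step, posPow_of_nonpos (show k + 3 ≠ 0 by omega) hr, posPow_of_nonneg _ (by norm_num)]
  norm_num

lemma one_le_posPow (N : ℕ) {r : ℝ} (hr : 1 ≤ r) : 1 ≤ posPow N r := by
  rw [posPow_of_nonneg _ (by linarith)]; exact one_le_pow₀ hr

lemma step_of_one_le (k : ℕ) {r : ℝ} (hr : 1 ≤ r) : step k r = 1 := by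
  have := one_le_posPow (k + 3) hr
  rw [step, posPow_of_nonpos (by omega) (by linarith), sub_zero]

lemma stepDeriv_nonneg (k : ℕ) (r : ℝ) : 0 ≤ stepDeriv k r := by
  have h1 := posPow_nonneg 1 (1 - posPow (k + 3) r)
  have h2 := posPow_nonneg (k + 2) r
  unfold stepDeriv; positivity

lemma stepDeriv_eq_zero (k : ℕ) {r : ℝ} (hr : ¬ (0 < r ∧ r < 1)) : stepDeriv k r = 0 := by
  rcases le_or_gt r 0 with h | h
  · simp [stepDeriv, posPow_of_nonpos (show k + 2 ≠ 0 by omega) h]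
  · have h1 : 1 ≤ r := by by_contra hh; exact hr ⟨h, by linarith⟩
    have := one_le_posPow (k + 3) h1
    simp [stepDeriv, posPow_of_nonpos (show 1 ≠ 0 by omega) (show 1 - posPow (k+3) r ≤ 0 by linarith)]

/-- The right side is 2β'(r), the weight that multiplies |∇u|^p in the energy inequality. This is
what lets the dissipation pay for the isoperimetric inequality. -/
lemma stepDeriv_le (k : ℕ) (r : ℝ) : stepDeriv k r ≤ 2 * ((k + 3) * posPow (k + 2) r) := by
  have h2 := posPow_nonneg (k + 2) r
  have h3 : posPow 1 (1 - posPow (k + 3) r) ≤ 1 := by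
    have := posPow_nonneg (k + 3) r
    simp only [posPow, pow_one] at *
    exact max_le (by linarith) zero_le_one
  unfold stepDeriv
  have : 0 ≤ ((k:ℝ) + 3) * posPow (k + 2) r := by positivity
  nlinarith

/-! ### Young-type inequalities and absorption of the diffusion -/

/-- Young's inequality, with an unspecified constant. -/
lemma exists_le_mul_rpow_add {p : ℝ} (hp : 1 < p) {δ : ℝ} (hδ : 0 < δ) :
    ∃ C : ℝ, 0 < C ∧ ∀ x : ℝ, 0 ≤ x → x ≤ δ * x ^ p + C := by
  -- The constant is the threshold beyond which δ x^p already exceeds x.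
  refine ⟨δ⁻¹ ^ (1 / (p - 1)), by positivity, fun x hx => ?_⟩
  rcases le_or_gt x (δ⁻¹ ^ (1 / (p - 1))) with h | h
  · have : 0 ≤ δ * x ^ p := by positivity
    linarith
  · have hR : 0 < δ⁻¹ ^ (1 / (p - 1)) := by positivity
    have hx0 : 0 < x := hR.trans h
    have h1 : δ⁻¹ ≤ x ^ (p - 1) := by
      have := Real.rpow_le_rpow hR.le h.le (show 0 ≤ p - 1 by linarith)
      rwa [← Real.rpow_mul (by positivity), one_div_mul_cancel (by linarith), Real.rpow_one] at this
    have h2 : x ^ p = x ^ (p - 1) * x := by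
      rw [← Real.rpow_add_one hx0.ne']; ring_nf
    have h3 : 1 ≤ δ * x ^ (p - 1) := by
      have := mul_le_mul_of_nonneg_left h1 hδ.le
      rwa [mul_inv_cancel₀ hδ.ne'] at this
    rw [h2, ← mul_assoc]
    nlinarith

/-- If δ r x^(p-2) ≥ 1, multiplying the left side by this factor gives the first term on the right.
Otherwise x² ≤ (δ r)^(-2/(p-2)), and the negative power of r is compensated by r^(k+1) exactly when
2/(p-2) ≤ k+1. This is the condition that fixes k. -/
lemma exists_pow_mul_sq_le {p : ℝ} (hp : 2 < p) {k : ℕ} (hk : 2 / (p - 2) ≤ k + 1) {M : ℝ}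
    (hM : 0 < M) {δ : ℝ} (hδ : 0 < δ) :
    ∃ C : ℝ, 0 < C ∧ ∀ r x : ℝ, 0 ≤ r → r ≤ M → 0 ≤ x →
      r ^ (k + 1) * x ^ 2 ≤ δ * (r ^ (k + 2) * x ^ p) + C := by
  refine ⟨M ^ (k + 1) * (1 / (δ * M)) ^ (2 / (p - 2)), by positivity, fun r x hr hrM hx => ?_⟩
  have hp2 : 0 < p - 2 := by linarith
  rcases hx.eq_or_lt with rfl | hx0
  · simp; positivity
  rcases hr.eq_or_lt with rfl | hr0
  · simp; positivity
  by_cases h : 1 ≤ δ * (r * x ^ (p - 2))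
  · have h2 : x ^ p = x ^ (p - 2) * x ^ 2 := by
      rw [← Real.rpow_natCast x 2, ← Real.rpow_add hx0]; norm_num
    have h4 : 0 ≤ r ^ (k + 1) * x ^ 2 := by positivity
    have h5 := mul_le_mul_of_nonneg_right h h4
    have h6 : 0 ≤ M ^ (k + 1) * (1 / (δ * M)) ^ (2 / (p - 2)) := by positivity
    rw [h2]
    calc _ ≤ δ * (r * x ^ (p - 2)) * (r ^ (k + 1) * x ^ 2) := by linarith
      _ = δ * (r ^ (k + 2) * (x ^ (p - 2) * x ^ 2)) := by ring
      _ ≤ _ := by linarith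
  · push Not at h
    have h1 : r / M * x ^ (p - 2) ≤ 1 / (δ * M) := by
      rw [le_div_iff₀ (by positivity)]
      field_simp; nlinarith
    have h2 := Real.rpow_le_rpow (by positivity) h1 (show 0 ≤ 2 / (p - 2) by positivity)
    rw [Real.mul_rpow (by positivity) (by positivity), ← Real.rpow_mul hx0.le,
      mul_div_cancel₀ _ hp2.ne'] at h2
    have h3 : (r / M) ^ (k + 1) ≤ (r / M) ^ (2 / (p - 2)) := by
      rw [← Real.rpow_natCast]
      exact Real.rpow_le_rpow_of_exponent_ge (by positivity) ((div_le_one hM).2 hrM)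
        (by push_cast; exact hk)
    have h4 : r ^ (k + 1) = M ^ (k + 1) * (r / M) ^ (k + 1) := by
      rw [div_pow]; field_simp
    have h5 : x ^ (2 : ℝ) = x ^ 2 := by exact_mod_cast Real.rpow_natCast x 2
    rw [h5] at h2
    have h6 : 0 ≤ δ * (r ^ (k + 2) * x ^ p) := by positivity
    rw [h4, mul_assoc]
    have : (r / M) ^ (k + 1) * x ^ 2 ≤ (1 / (δ * M)) ^ (2 / (p - 2)) :=
      (mul_le_mul_of_nonneg_right h3 (by positivity)).trans h2
    have := mul_le_mul_of_nonneg_left this (show 0 ≤ M ^ (k + 1) by positivity)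
    linarith

/-- Absorption of the diffusion terms into the gradient term. -/
lemma exists_absorb {p : ℝ} (hp : 2 < p) {k : ℕ} (hk : 2 / (p - 2) ≤ k + 1) {M c : ℝ}
    (hM : 0 < M) (hc : 0 < c) {Λ : ℝ} (hΛ : 0 < Λ) {L : ℝ} (hL : 0 ≤ L) :
    ∃ C : ℝ, 0 < C ∧ ∀ r x s : ℝ, r ≤ M → 0 ≤ x → 0 ≤ s → s ≤ 1 →
      Λ * ((k + 3) * ((k + 2) * posPow (k + 1) r)) * x ^ 2 * s ^ 2
        + 2 * Λ * L * ((k + 3) * posPow (k + 2) r) * (x * s)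
      ≤ c / 2 * (((k + 3) * posPow (k + 2) r) * s ^ 2 * x ^ p) + C := by
  -- The available c/2 is shared equally between the Hessian term and the cutoff term. Using L + 1
  -- below avoids dividing by zero when L = 0.
  obtain ⟨C₁, hC₁, h₁⟩ := exists_pow_mul_sq_le hp hk hM
    (show 0 < c / 4 / (Λ * (k + 2)) by positivity)
  obtain ⟨C₂, hC₂, h₂⟩ := exists_le_mul_rpow_add (show 1 < p by linarith)
    (show 0 < c / 4 / (2 * Λ * (L + 1)) by positivity)
  refine ⟨Λ * (k + 2) * (k + 3) * C₁ + 2 * Λ * (L + 1) * (k + 3) * M ^ (k + 2) * C₂,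
    by positivity, fun r x s hr hx hs hs1 => ?_⟩
  set R := max r 0 with hR
  have hR0 : 0 ≤ R := le_max_right _ _
  have hRM : R ≤ M := max_le hr hM.le
  have e1 : posPow (k + 1) r = R ^ (k + 1) := rfl
  have e2 : posPow (k + 2) r = R ^ (k + 2) := rfl
  rw [e1, e2]
  have a1 := h₁ R x hR0 hRM hx
  have a2 := h₂ (x * s) (by positivity)
  -- Since p > 2 and 0 ≤ s ≤ 1, the square of the cutoff is enough to absorb the cross term.
  have a3 : (x * s) ^ p ≤ s ^ 2 * x ^ p := by
    rw [Real.mul_rpow hx hs, mul_comm]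
    refine mul_le_mul_of_nonneg_right ?_ (by positivity)
    rcases hs.eq_or_lt with rfl | hs0
    · rw [Real.zero_rpow (by linarith)]; positivity
    · rw [← Real.rpow_natCast s 2]
      exact Real.rpow_le_rpow_of_exponent_ge hs0 hs1 (by push_cast; exact hp.le)
  have hxp : 0 ≤ x ^ p := by positivity
  have b1 : Λ * ((k + 3) * ((k + 2) * R ^ (k + 1))) * x ^ 2 * s ^ 2
      ≤ c / 4 * (((k + 3) * R ^ (k + 2)) * s ^ 2 * x ^ p) + Λ * (k + 2) * (k + 3) * C₁ := by
    have := mul_le_mul_of_nonneg_left a1 (show 0 ≤ Λ * (k + 2) * (k + 3) * s ^ 2 by positivity)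
    have e : Λ * (k + 2) * (k + 3) * s ^ 2 * (c / 4 / (Λ * (k + 2)) * (R ^ (k + 2) * x ^ p) + C₁)
       = c / 4 * (((k + 3) * R ^ (k + 2)) * s ^ 2 * x ^ p) + Λ * (k + 2) * (k + 3) * C₁ * s ^ 2 := by
      field_simp
    rw [e] at this
    have h3 : Λ * (k + 2) * (k + 3) * C₁ * s ^ 2 ≤ Λ * (k + 2) * (k + 3) * C₁ :=
      mul_le_of_le_one_right (by positivity) (pow_le_one₀ hs hs1)
    linarith
  have b2 : 2 * Λ * L * ((k + 3) * R ^ (k + 2)) * (x * s)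
      ≤ c / 4 * (((k + 3) * R ^ (k + 2)) * s ^ 2 * x ^ p)
        + 2 * Λ * (L + 1) * (k + 3) * M ^ (k + 2) * C₂ := by
    have a4 : x * s ≤ c / 4 / (2 * Λ * (L + 1)) * (s ^ 2 * x ^ p) + C₂ :=
      a2.trans (by gcongr)
    have := mul_le_mul_of_nonneg_left a4
      (show 0 ≤ 2 * Λ * (L + 1) * ((k + 3) * R ^ (k + 2)) by positivity)
    have e : 2 * Λ * (L + 1) * ((k + 3) * R ^ (k + 2)) *
        (c / 4 / (2 * Λ * (L + 1)) * (s ^ 2 * x ^ p) + C₂)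
       = c / 4 * (((k + 3) * R ^ (k + 2)) * s ^ 2 * x ^ p)
        + 2 * Λ * (L + 1) * (k + 3) * R ^ (k + 2) * C₂ := by
      field_simp
    rw [e] at this
    have h3 : 2 * Λ * (L + 1) * (k + 3) * R ^ (k + 2) * C₂
        ≤ 2 * Λ * (L + 1) * (k + 3) * M ^ (k + 2) * C₂ := by gcongr
    have h4 : 2 * Λ * L * ((k + 3) * R ^ (k + 2)) * (x * s)
        ≤ 2 * Λ * (L + 1) * ((k + 3) * R ^ (k + 2)) * (x * s) := by
      gcongr; linarith
    linarith
  linarith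

variable {n : ℕ}

/-! ### Classical subsolutions and the energy inequality -/

/-- The spatial divergence of a vector field on space-time. -/
noncomputable def spaceDiv (F : ℝ × Space n → Space n) (z : ℝ × Space n) : ℝ :=
  ∑ i, fderiv ℝ F z (0, EuclideanSpace.single i 1) i

/-- The space-time cylinder over a closed ball on which mollified subsolutions are considered. -/
def slab (n : ℕ) (a b : ℝ) : Set (ℝ × Space n) :=
  Icc a b ×ˢ Metric.closedBall (0 : Space n) (5 / 2)

/-- A classical subsolution of `∂ₜ u + c |∇u|ᵖ ≤ div F + f` bounded by `M`, where `G` dominates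
both the gradient and the flux. -/
structure IsClassicalSubsolution (c Λ M p a b : ℝ) (u f G : ℝ × Space n → ℝ)
    (F : ℝ × Space n → Space n) : Prop where
  contDiff_u : ContDiff ℝ 1 u
  contDiff_F : ContDiff ℝ 1 F
  continuous_f : Continuous f
  continuous_G : Continuous G
  nonneg_G : ∀ z, 0 ≤ G z
  le : ∀ z ∈ slab n a b, u z ≤ M
  grad_le : ∀ z ∈ slab n a b, ∀ v : Space n, |fderiv ℝ u z (0, v)| ≤ G z * ‖v‖
  flux_le : ∀ z ∈ slab n a b, ‖F z‖ ≤ Λ * G z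
  subsol : ∀ z ∈ slab n a b, fderiv ℝ u z (1, 0) + c * G z ^ p ≤ spaceDiv F z + f z

lemma integral_mul_div_eq {ψ : Space n → ℝ} {F : Space n → Space n} (hψ : ContDiff ℝ 1 ψ)
    (hc : HasCompactSupport ψ) (hF : ContDiff ℝ 1 F) :
    ∫ x, ψ x * ∑ i, fderiv ℝ F x (EuclideanSpace.single i 1) i
      = - ∫ x, fderiv ℝ ψ x (F x) := by
  have hFi : ∀ i, ContDiff ℝ 1 (fun x => F x i) := fun i => by fun_prop
  have hdψ : Continuous (fderiv ℝ ψ) := hψ.continuous_fderiv one_ne_zero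
  have hdF : Continuous (fderiv ℝ F) := hF.continuous_fderiv one_ne_zero
  have hder : ∀ i x v, fderiv ℝ (fun x => F x i) x v = fderiv ℝ F x v i := fun i x v => by
    have h := (hF.differentiable one_ne_zero x).hasFDerivAt
    have := ((EuclideanSpace.proj (𝕜 := ℝ) i).hasFDerivAt.comp x h).fderiv
    exact congrArg (fun L => L v) this
  have key : ∀ i, ∫ x, ψ x * fderiv ℝ F x (EuclideanSpace.single i 1) i
      = - ∫ x, fderiv ℝ ψ x (EuclideanSpace.single i 1) * F x i := fun i => by
    have := integral_mul_fderiv_eq_neg_fderiv_mul_of_integrable (μ := volume) (f := ψ)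
      (g := fun x => F x i) (v := EuclideanSpace.single i 1) ?_ ?_ ?_
      (fun x _ => hψ.differentiable one_ne_zero x) (fun x _ => (hFi i).differentiable one_ne_zero x)
    · simpa only [hder] using this
    · refine Continuous.integrable_of_hasCompactSupport (by fun_prop) ?_
      exact (hc.fderiv_apply ℝ _).mul_right
    · simp only [hder]
      exact Continuous.integrable_of_hasCompactSupport (by fun_prop) hc.mul_right
    · exact Continuous.integrable_of_hasCompactSupport (by fun_prop) hc.mul_right
  simp_rw [Finset.mul_sum]
  rw [integral_finsetSum (f := fun i x => ψ x * fderiv ℝ F x (EuclideanSpace.single i 1) i) _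
    fun i _ => Continuous.integrable_of_hasCompactSupport (by fun_prop) hc.mul_right]
  simp_rw [key, Finset.sum_neg_distrib]
  rw [← integral_finsetSum (f := fun i x => fderiv ℝ ψ x (EuclideanSpace.single i 1) * F x i) _
    fun i _ => Continuous.integrable_of_hasCompactSupport (by fun_prop)
      (hc.fderiv_apply ℝ _).mul_right]
  congr 1
  refine integral_congr_ae (Filter.Eventually.of_forall fun x => ?_)
  have h := (EuclideanSpace.basisFun (Fin n) ℝ).sum_repr (F x)
  dsimp only
  conv_rhs => rw [← h]
  simp [map_sum, mul_comm]

lemma Continuous.integrable_slab {k : ℝ × Space n → ℝ} (hk : Continuous k) (s t : ℝ) :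
    Integrable k ((volume.restrict (Ioc s t)).prod
      (volume.restrict (Metric.closedBall (0 : Space n) (5 / 2)))) := by
  rw [Measure.prod_restrict]
  exact (hk.continuousOn.integrableOn_compact (isCompact_Icc.prod
    (isCompact_closedBall (0 : Space n) (5 / 2)))).mono_set (prod_mono Ioc_subset_Icc_self le_rfl)

/-- The localized mass `∫ β(u(t, x)) ξ(x)² dx`, with `β = posPow (k + 3)`. -/
noncomputable def mass (k : ℕ) (ξ : Space n → ℝ) (u : ℝ × Space n → ℝ) (t : ℝ) : ℝ :=
  ∫ x in Metric.closedBall (0 : Space n) (5 / 2), posPow (k + 3) (u (t, x)) * ξ x ^ 2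

/-- The localized dissipation density. -/
noncomputable def dissip (k : ℕ) (p : ℝ) (ξ : Space n → ℝ) (u G : ℝ × Space n → ℝ)
    (z : ℝ × Space n) : ℝ :=
  ((k + 3) * posPow (k + 2) (u z)) * ξ z.2 ^ 2 * G z ^ p

lemma continuous_dissip {k : ℕ} {p : ℝ} (hp : 0 ≤ p) {ξ : Space n → ℝ} {u G : ℝ × Space n → ℝ}
    (hξ : Continuous ξ) (hu : Continuous u) (hG : Continuous G) :
    Continuous (dissip k p ξ u G) := by
  unfold dissip
  have : Continuous fun z => G z ^ p := hG.rpow_const fun _ => Or.inr hp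
  fun_prop

/-- The fundamental theorem of calculus in time at each fixed x, followed by Fubini. -/
lemma mass_sub_mass {k : ℕ} {ξ : Space n → ℝ} (hξ : Continuous ξ) {u : ℝ × Space n → ℝ}
    (hu : ContDiff ℝ 1 u) {s t : ℝ} (hst : s ≤ t) :
    mass k ξ u t - mass k ξ u s = ∫ r in Ioc s t,
      ∫ x in Metric.closedBall (0 : Space n) (5 / 2),
        ((k + 3) * posPow (k + 2) (u (r, x))) * fderiv ℝ u (r, x) (1, 0) * ξ x ^ 2 := by
  have hdu : Continuous (fderiv ℝ u) := hu.continuous_fderiv one_ne_zero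
  have huc := hu.continuous
  rw [integral_integral_swap]
  · unfold mass
    rw [← integral_sub]
    · refine integral_congr_ae (Filter.Eventually.of_forall fun x => ?_)
      have hd : ∀ r, HasDerivAt (fun r => posPow (k + 3) (u (r, x)) * ξ x ^ 2)
          (((k + 3) * posPow (k + 2) (u (r, x))) * fderiv ℝ u (r, x) (1, 0) * ξ x ^ 2) r := by
        intro r
        have h1 : HasDerivAt (fun r => u (r, x)) (fderiv ℝ u (r, x) (1, 0)) r :=
          (hu.differentiable one_ne_zero (r, x)).hasFDerivAt.comp_hasDerivAt r
            ((hasDerivAt_id r).prodMk (hasDerivAt_const r x))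
        have h2 := hasDerivAt_posPow (k + 1) (u (r, x))
        refine ((h2.comp r h1).mul_const (ξ x ^ 2)).congr_deriv ?_
        push_cast; ring
      simp only
      rw [← intervalIntegral.integral_of_le hst,
        intervalIntegral.integral_eq_sub_of_hasDerivAt (fun r _ => hd r)]
      exact Continuous.intervalIntegrable (by fun_prop) _ _
    all_goals
      exact Continuous.continuousOn (by fun_prop) |>.integrableOn_compact (isCompact_closedBall _ _)
  · exact Continuous.integrable_slab (k := fun z => ((k + 3) * posPow (k + 2) (u z))
      * fderiv ℝ u z (1, 0) * ξ z.2 ^ 2) (by fun_prop) s t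

/-- The energy inequality on a time slice. -/
lemma exists_slice_energy {p : ℝ} (hp : 2 < p) {k : ℕ} (hk : 2 / (p - 2) ≤ k + 1) {M c : ℝ}
    (hM : 0 < M) (hc : 0 < c) {Λ : ℝ} (hΛ : 0 < Λ) (ξ : ContDiffBump (0 : Space n))
    (hξ : ξ.rOut ≤ 5 / 2) :
    ∃ C : ℝ, 0 < C ∧ ∀ (a b : ℝ) (u f G : ℝ × Space n → ℝ) (F : ℝ × Space n → Space n),
      IsClassicalSubsolution c Λ M p a b u f G F → ∀ t ∈ Icc a b,
      ∫ x in Metric.closedBall (0 : Space n) (5 / 2),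
        ((k + 3) * posPow (k + 2) (u (t, x))) * fderiv ℝ u (t, x) (1, 0) * ξ x ^ 2
      ≤ ∫ x in Metric.closedBall (0 : Space n) (5 / 2),
        (-(c / 2) * dissip k p ξ u G (t, x) + C + C * |f (t, x)|) := by
  have hξd : Continuous (fderiv ℝ ξ) := (ξ.contDiff (n := 1)).continuous_fderiv one_ne_zero
  obtain ⟨L, hL⟩ : ∃ L : ℝ, ∀ x, ‖fderiv ℝ ξ x‖ ≤ L :=
    (ξ.hasCompactSupport.fderiv (𝕜 := ℝ)).exists_bound_of_continuous hξd
  have hL0 : 0 ≤ L := (norm_nonneg _).trans (hL 0)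
  obtain ⟨C₁, hC₁, h₁⟩ := exists_absorb hp hk hM hc hΛ hL0
  set C₂ : ℝ := (k + 3) * M ^ (k + 2) with hC₂
  have hC₂0 : 0 ≤ C₂ := by positivity
  refine ⟨C₁ + C₂, by positivity, fun a b u f G F h t ht => ?_⟩
  have hu := h.contDiff_u
  have hF := h.contDiff_F
  have hG := h.continuous_G
  have hf := h.continuous_f
  have huc := hu.continuous
  have hFc := hF.continuous
  have hdu : Continuous (fderiv ℝ u) := hu.continuous_fderiv one_ne_zero
  have hdF : Continuous (fderiv ℝ F) := hF.continuous_fderiv one_ne_zero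
  have hξc := ξ.continuous
  have hGp : Continuous fun z => G z ^ p := hG.rpow_const fun _ => Or.inr (by linarith)
  have hdis := continuous_dissip (k := k) (p := p) (by linarith) hξc huc hG
  set B := Metric.closedBall (0 : Space n) (5 / 2) with hB
  have hBc : IsCompact B := isCompact_closedBall _ _
  -- The test function β'(u)ξ² on the slice; multiplying ∂ₜu by it gives the density of the time
  -- derivative of the mass.
  set ψ : Space n → ℝ := fun x => ((k + 3) * posPow (k + 2) (u (t, x))) * ξ x ^ 2 with hψdef
  have hslice : ∀ x, HasFDerivAt (fun x => u (t, x))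
      ((fderiv ℝ u (t, x)).comp (ContinuousLinearMap.inr ℝ ℝ (Space n))) x := fun x =>
    (hu.differentiable one_ne_zero (t, x)).hasFDerivAt.comp x (hasFDerivAt_prodMk_right t x)
  have hsliceF : ∀ x, HasFDerivAt (fun x => F (t, x))
      ((fderiv ℝ F (t, x)).comp (ContinuousLinearMap.inr ℝ ℝ (Space n))) x := fun x =>
    (hF.differentiable one_ne_zero (t, x)).hasFDerivAt.comp x (hasFDerivAt_prodMk_right t x)
  have hψder : ∀ x, HasFDerivAt ψ
      (((k + 3) * posPow (k + 2) (u (t, x))) • ((2 * ξ x) • fderiv ℝ ξ x)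
      + (ξ x ^ 2) • (((k + 3) * ((k + 2) * posPow (k + 1) (u (t, x)))) •
        ((fderiv ℝ u (t, x)).comp (ContinuousLinearMap.inr ℝ ℝ (Space n))))) x := by
    intro x
    have h1 := (hasDerivAt_posPow k (u (t, x))).comp_hasFDerivAt x (hslice x)
    have h2 := ((ξ.contDiff (n := 1)).differentiable one_ne_zero x).hasFDerivAt.pow 2
    have h3 := (h1.const_mul ((k : ℝ) + 3)).mul h2
    refine h3.congr_fderiv ?_
    ext v
    simp only [Function.comp_apply, nsmul_eq_mul, add_apply,
      smul_apply, smul_eq_mul, Nat.add_one_sub_one, pow_one]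
    push_cast
    ring
  -- The exponent k + 2 is at least 2, so β' is C¹ and ψ may be integrated by parts.
  have hψ : ContDiff ℝ 1 ψ := by
    rw [contDiff_one_iff_fderiv]
    refine ⟨fun x => (hψder x).differentiableAt, ?_⟩
    rw [funext fun x => (hψder x).fderiv]
    fun_prop
  have hψc : HasCompactSupport ψ := by
    have : HasCompactSupport fun x => ξ x * ξ x := ξ.hasCompactSupport.mul_left
    simp only [hψdef, sq]
    exact this.mul_left
  have hξ0 : ∀ x, x ∉ B → ξ x = 0 := fun x hx => ξ.zero_of_le_dist (by
    simp only [hB, Metric.mem_closedBall, not_le] at hx; linarith)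
  have hmem : ∀ x ∈ B, (t, x) ∈ slab n a b := fun x hx => ⟨ht, hx⟩
  -- integration by parts
  have hibp : ∫ x, ψ x * spaceDiv F (t, x) = - ∫ x,
      (((k + 3) * posPow (k + 2) (u (t, x))) * (2 * ξ x) * fderiv ℝ ξ x (F (t, x))
      + (ξ x ^ 2 * ((k + 3) * ((k + 2) * posPow (k + 1) (u (t, x)))))
        * fderiv ℝ u (t, x) (0, F (t, x))) := by
    have := integral_mul_div_eq hψ hψc (F := fun x => F (t, x)) (by fun_prop)
    simp only [(hsliceF _).fderiv, (hψder _).fderiv, add_apply,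
      smul_apply, smul_eq_mul, ContinuousLinearMap.comp_apply,
      ContinuousLinearMap.inr_apply] at this
    simp only [spaceDiv, mul_assoc] at this ⊢
    exact this
  have hset1 : ∫ x in B, ψ x * spaceDiv F (t, x) = ∫ x, ψ x * spaceDiv F (t, x) :=
    setIntegral_eq_integral_of_forall_compl_eq_zero
      fun x hx => by simp only [hψdef, hξ0 x hx]; ring
  have hset2 : ∫ x in B, (((k + 3) * posPow (k + 2) (u (t, x))) * (2 * ξ x) *
        fderiv ℝ ξ x (F (t, x)) + (ξ x ^ 2 * ((k + 3) * ((k + 2) * posPow (k + 1) (u (t, x)))))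
        * fderiv ℝ u (t, x) (0, F (t, x))) = _ :=
    setIntegral_eq_integral_of_forall_compl_eq_zero fun x hx => by simp [hξ0 x hx]
  rw [← hset1, ← hset2] at hibp
  have hint : ∀ {q : Space n → ℝ}, Continuous q → IntegrableOn q B := fun hq =>
    hq.continuousOn.integrableOn_compact hBc
  have step1 : ∫ x in B, ((k + 3) * posPow (k + 2) (u (t, x))) * fderiv ℝ u (t, x) (1, 0) * ξ x ^ 2
      ≤ ∫ x in B, (ψ x * spaceDiv F (t, x) + ψ x * (f (t, x) - c * G (t, x) ^ p)) := by
    refine setIntegral_mono_on (hint (by fun_prop)) (hint ?_) measurableSet_closedBall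
      fun x hx => ?_
    · unfold spaceDiv; fun_prop (disch := linarith)
    · have h0 : 0 ≤ ψ x := by
        have := posPow_nonneg (k + 2) (u (t, x))
        simp only [hψdef]; positivity
      have h1 := h.subsol _ (hmem x hx)
      have h2 := mul_le_mul_of_nonneg_left
        (show fderiv ℝ u (t, x) (1, 0) ≤ spaceDiv F (t, x) + (f (t, x) - c * G (t, x) ^ p) by
          linarith) h0
      simp only [hψdef] at h2 ⊢
      linarith
  refine step1.trans ?_
  rw [integral_add (hint (by unfold spaceDiv; fun_prop)) (hint (by fun_prop (disch := linarith))),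
    hibp, ← integral_neg, ← integral_add (hint (by fun_prop)) (hint (by fun_prop (disch := linarith)))]
  refine setIntegral_mono_on (hint (by fun_prop (disch := linarith))) (hint (by fun_prop))
    measurableSet_closedBall
    fun x hx => ?_
  have g1 := h.grad_le _ (hmem x hx) (F (t, x))
  have g2 := h.flux_le _ (hmem x hx)
  have g3 := h.le _ (hmem x hx)
  have g0 := h.nonneg_G (t, x)
  have g4 := h₁ (u (t, x)) (G (t, x)) (ξ x) g3 g0 ξ.nonneg ξ.le_one
  have g5 : |fderiv ℝ ξ x (F (t, x))| ≤ L * (Λ * G (t, x)) := by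
    refine ((fderiv ℝ ξ x).le_opNorm _).trans ?_
    gcongr
    exact hL x
  -- Only the size of the flux enters; no sign of ∇u · F is needed.
  have g6 : |fderiv ℝ u (t, x) (0, F (t, x))| ≤ Λ * G (t, x) ^ 2 := by
    refine g1.trans ?_
    nlinarith
  have q1 : 0 ≤ posPow (k + 1) (u (t, x)) := posPow_nonneg _ _
  have q2 : 0 ≤ posPow (k + 2) (u (t, x)) := posPow_nonneg _ _
  have q3 : 0 ≤ ξ x := ξ.nonneg
  have q4 : ξ x ≤ 1 := ξ.le_one
  have r1 : -(((k + 3) * posPow (k + 2) (u (t, x))) * (2 * ξ x) * fderiv ℝ ξ x (F (t, x)))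
      ≤ ((k + 3) * posPow (k + 2) (u (t, x))) * (2 * ξ x) * (L * (Λ * G (t, x))) := by
    rw [← mul_neg]
    exact mul_le_mul_of_nonneg_left ((neg_le_abs _).trans g5) (by positivity)
  have r2 : -((ξ x ^ 2 * ((k + 3) * ((k + 2) * posPow (k + 1) (u (t, x)))))
        * fderiv ℝ u (t, x) (0, F (t, x)))
      ≤ (ξ x ^ 2 * ((k + 3) * ((k + 2) * posPow (k + 1) (u (t, x))))) * (Λ * G (t, x) ^ 2) := by
    rw [← mul_neg]
    exact mul_le_mul_of_nonneg_left ((neg_le_abs _).trans g6) (by positivity)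
  have r3 : ψ x * f (t, x) ≤ C₂ * |f (t, x)| := by
    have w1 : posPow (k + 2) (u (t, x)) ≤ M ^ (k + 2) := by
      rw [← posPow_of_nonneg _ hM.le]; exact posPow_mono _ g3
    have w2 : ψ x ≤ C₂ := by
      simp only [hψdef, hC₂]
      refine (mul_le_of_le_one_right (by positivity) (pow_le_one₀ q3 q4)).trans ?_
      gcongr
    have w3 : 0 ≤ ψ x := by simp only [hψdef]; positivity
    calc ψ x * f (t, x) ≤ ψ x * |f (t, x)| := mul_le_mul_of_nonneg_left (le_abs_self _) w3
      _ ≤ _ := mul_le_mul_of_nonneg_right w2 (abs_nonneg _)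
  have r4 : 0 ≤ C₁ * |f (t, x)| := by positivity
  simp only [dissip]
  have e2 : ψ x * (f (t, x) - c * G (t, x) ^ p) = ψ x * f (t, x)
      - c * (((k + 3) * posPow (k + 2) (u (t, x))) * ξ x ^ 2 * G (t, x) ^ p) := by
    simp only [hψdef]; ring
  rw [e2]
  linarith

/-- The energy inequality between two times. -/
lemma exists_energy {p : ℝ} (hp : 2 < p) {k : ℕ} (hk : 2 / (p - 2) ≤ k + 1) {M c : ℝ}
    (hM : 0 < M) (hc : 0 < c) {Λ : ℝ} (hΛ : 0 < Λ) (ξ : ContDiffBump (0 : Space n))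
    (hξ : ξ.rOut ≤ 5 / 2) :
    ∃ C : ℝ, 0 < C ∧ ∀ (a b : ℝ) (u f G : ℝ × Space n → ℝ) (F : ℝ × Space n → Space n),
      IsClassicalSubsolution c Λ M p a b u f G F → ∀ s t, a ≤ s → s ≤ t → t ≤ b →
      mass k ξ u t - mass k ξ u s
        + c / 2 * ∫ r in Ioc s t, ∫ x in Metric.closedBall (0 : Space n) (5 / 2),
          dissip k p ξ u G (r, x)
      ≤ C * (t - s) + C * ∫ r in Ioc s t, ∫ x in Metric.closedBall (0 : Space n) (5 / 2),
          |f (r, x)| := by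
  obtain ⟨C, hC, h₁⟩ := exists_slice_energy hp hk hM hc hΛ ξ hξ
  set B := Metric.closedBall (0 : Space n) (5 / 2) with hB
  set V := volume.real B with hV
  have hV0 : 0 ≤ V := measureReal_nonneg
  -- Integrating the constant term of the slice inequality over the ball produces the factor V.
  refine ⟨C + C * V, by positivity, fun a b u f G F h s t has hst htb => ?_⟩
  have huc := h.contDiff_u.continuous
  have hf := h.continuous_f
  have hdu : Continuous (fderiv ℝ u) := h.contDiff_u.continuous_fderiv one_ne_zero
  have hξc := ξ.continuous
  have hdis := continuous_dissip (k := k) (p := p) (by linarith) hξc huc h.continuous_G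
  rw [mass_sub_mass ξ.continuous h.contDiff_u hst, ← hB]
  have i1 := (Continuous.integrable_slab hdis s t).integral_prod_left
  have i2 := (Continuous.integrable_slab (k := fun z => |f z|) (by fun_prop) s t).integral_prod_left
  have i3 := (Continuous.integrable_slab (k := fun z => ((k + 3) * posPow (k + 2) (u z))
      * fderiv ℝ u z (1, 0) * ξ z.2 ^ 2) (by fun_prop) s t).integral_prod_left
  rw [← hB] at i1 i2 i3
  have hint : ∀ {q : Space n → ℝ}, Continuous q → IntegrableOn q B := fun hq =>
    hq.continuousOn.integrableOn_compact (isCompact_closedBall _ _)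
  have i4 : IntegrableOn (fun r => (-(c / 2) * ∫ x in B, dissip k p ξ u G (r, x)) + V * C)
    (Ioc s t) := (i1.const_mul _).add (integrable_const _)
  have key : ∫ r in Ioc s t, ∫ x in B,
        ((k + 3) * posPow (k + 2) (u (r, x))) * fderiv ℝ u (r, x) (1, 0) * ξ x ^ 2
      ≤ ∫ r in Ioc s t, (-(c / 2) * ∫ x in B, dissip k p ξ u G (r, x)) + V * C
        + C * ∫ x in B, |f (r, x)| := by
    refine setIntegral_mono_on i3 (i4.add (i2.const_mul _)) measurableSet_Ioc fun r hr => ?_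
    refine (h₁ a b u f G F h r ⟨has.trans hr.1.le, hr.2.trans htb⟩).trans (le_of_eq ?_)
    rw [integral_add (hint (by fun_prop)) (hint (by fun_prop)),
      integral_add (hint (by fun_prop)) (hint (by fun_prop)), integral_const_mul,
      integral_const_mul, setIntegral_const, smul_eq_mul]
  rw [integral_add i4 (i2.const_mul _),
    integral_add (i1.const_mul _) (integrable_const _), integral_const_mul, integral_const_mul,
    integral_const_mul, setIntegral_const, smul_eq_mul, Real.volume_real_Ioc_of_le hst] at key
  have n1 : 0 ≤ ∫ r in Ioc s t, ∫ x in B, |f (r, x)| :=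
    integral_nonneg fun r => integral_nonneg fun x => abs_nonneg _
  have n2 : 0 ≤ C * V * ∫ r in Ioc s t, ∫ x in B, |f (r, x)| := by positivity
  have n3 : 0 ≤ C * (t - s) := mul_nonneg hC.le (by linarith)
  linarith

/-! ### The isoperimetric inequality -/

lemma lintegral_comp_add_smul_le {K : Space n → ENNReal} (hK : Measurable K) (x : Space n) {s : ℝ}
    (hs : 1 / 2 ≤ s) : ∫⁻ y, K (x + s • y) ≤ 2 ^ n * ∫⁻ y, K y := by
  have hs0 : 0 < s := by linarith
  have hm : Measurable fun z => K (x + z) := hK.comp (measurable_const_add x)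
  have h1 : ∫⁻ y, K (x + s • y) = ∫⁻ z, K (x + z) ∂(Measure.map (s • ·) volume) :=
    (lintegral_map hm (measurable_const_smul s)).symm
  rw [h1, Measure.map_addHaar_smul _ hs0.ne', lintegral_smul_measure,
    lintegral_add_left_eq_self K x, smul_eq_mul]
  gcongr
  rw [finrank_euclideanSpace_fin]
  have : |(s ^ n)⁻¹| ≤ (2 : ℝ) ^ n := by
    rw [abs_of_pos (by positivity), ← inv_pow]
    refine pow_le_pow_left₀ (by positivity) ?_ _
    rw [inv_le_comm₀ hs0 (by norm_num)]
    linarith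
  refine (ENNReal.ofReal_le_ofReal this).trans (le_of_eq ?_)
  rw [ENNReal.ofReal_pow (by norm_num)]
  norm_num

/-- Integrating a density along all segments joining two sets costs at most a multiple of its
total mass. -/
lemma lintegral_segment_le {K : Space n → ENNReal} (hK : Measurable K) {S T : Set (Space n)}
    {V : ENNReal} (hS : volume S ≤ V) (hT : volume T ≤ V) :
    ∫⁻ x in S, ∫⁻ y in T, ∫⁻ s in Icc (0 : ℝ) 1, K (x + s • (y - x)) ≤ 2 ^ n * V * ∫⁻ y, K y := by
  have e1 : ∫⁻ x in S, ∫⁻ y in T, ∫⁻ s in Icc (0 : ℝ) 1, K (x + s • (y - x))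
      = ∫⁻ s in Icc (0 : ℝ) 1, ∫⁻ x in S, ∫⁻ y in T, K (x + s • (y - x)) := by
    have e2 : ∀ x, ∫⁻ y in T, ∫⁻ s in Icc (0 : ℝ) 1, K (x + s • (y - x))
        = ∫⁻ s in Icc (0 : ℝ) 1, ∫⁻ y in T, K (x + s • (y - x)) := fun x =>
      lintegral_lintegral_swap (hK.comp (by fun_prop : Continuous fun z : Space n × ℝ =>
        x + z.2 • (z.1 - x)).measurable).aemeasurable
    simp_rw [e2]
    refine lintegral_lintegral_swap (Measurable.aemeasurable ?_)
    exact Measurable.lintegral_prod_right' (f := fun z : (Space n × ℝ) × Space n =>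
      K (z.1.1 + z.1.2 • (z.2 - z.1.1))) (hK.comp (by fun_prop : Continuous
        fun z : (Space n × ℝ) × Space n => z.1.1 + z.1.2 • (z.2 - z.1.1)).measurable)
  rw [e1]
  have hs : ∀ s ∈ Icc (0 : ℝ) 1, ∫⁻ x in S, ∫⁻ y in T, K (x + s • (y - x))
      ≤ 2 ^ n * V * ∫⁻ y, K y := by
    intro s hs
    -- The point x + s(y - x) scales by s in y and by 1 - s in x. Integrating first in the variable
    -- whose factor is at least 1/2 keeps the Jacobian below 2^n.
    rcases le_total (1 / 2) s with h | h
    · calc _ ≤ ∫⁻ x in S, 2 ^ n * ∫⁻ y, K y := by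
            refine lintegral_mono fun x => ?_
            refine (setLIntegral_le_lintegral _ _).trans ?_
            refine le_trans (le_of_eq ?_) (lintegral_comp_add_smul_le hK ((1 - s) • x) h)
            refine lintegral_congr fun y => ?_
            congr 1; module
        _ = 2 ^ n * (∫⁻ y, K y) * volume S := by rw [setLIntegral_const]
        _ ≤ 2 ^ n * (∫⁻ y, K y) * V := by gcongr
        _ = _ := by ring
    · rw [lintegral_lintegral_swap]
      · calc _ ≤ ∫⁻ x in T, 2 ^ n * ∫⁻ y, K y := by
              refine lintegral_mono fun y => ?_
              refine (setLIntegral_le_lintegral _ _).trans ?_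
              refine le_trans (le_of_eq ?_)
                (lintegral_comp_add_smul_le hK (s • y) (show 1 / 2 ≤ 1 - s by linarith))
              refine lintegral_congr fun x => ?_
              congr 1; module
          _ = 2 ^ n * (∫⁻ y, K y) * volume T := by rw [setLIntegral_const]
          _ ≤ 2 ^ n * (∫⁻ y, K y) * V := by gcongr
          _ = _ := by ring
      · exact (hK.comp (by fun_prop : Continuous fun z : Space n × Space n =>
          z.1 + s • (z.2 - z.1)).measurable).aemeasurable
  refine (setLIntegral_mono' measurableSet_Icc hs).trans (le_of_eq ?_)
  rw [setLIntegral_const]; simp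

/-- A De Giorgi isoperimetric inequality: the product of the measures of a sublevel and of a
superlevel set is controlled by the gradient in the intermediate region. -/
lemma volume_mul_volume_le {k : ℕ} {U G : Space n → ℝ} (hU : ContDiff ℝ 1 U) (hG : Continuous G)
    (hG0 : ∀ x, 0 ≤ G x)
    (hg : ∀ x ∈ Metric.ball (0 : Space n) 2, ∀ v, |fderiv ℝ U x v| ≤ G x * ‖v‖) :
    volume.real (Metric.ball (0 : Space n) 2 ∩ {x | U x ≤ 0})
      * volume.real (Metric.ball (0 : Space n) 2 ∩ {x | 1 ≤ U x})
    ≤ 4 * (2 ^ n * volume.real (Metric.ball (0 : Space n) 2))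
      * ∫ x in Metric.ball (0 : Space n) 2, stepDeriv k (U x) * G x := by
  set B := Metric.ball (0 : Space n) 2 with hB
  set K : Space n → ℝ := fun x => stepDeriv k (U x) * G x with hKdef
  have hUc := hU.continuous
  have hKc : Continuous K := by fun_prop
  have hK0 : ∀ x, 0 ≤ K x := fun x => mul_nonneg (stepDeriv_nonneg _ _) (hG0 x)
  set S := B ∩ {x | U x ≤ 0}
  set T := B ∩ {x | 1 ≤ U x}
  set K' : Space n → ENNReal := B.indicator fun x => ENNReal.ofReal (K x) with hK'
  have hK'm : Measurable K' :=
    (ENNReal.measurable_ofReal.comp hKc.measurable).indicator Metric.isOpen_ball.measurableSet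
  -- Along a segment from S to T the function step(U) goes from 0 to 1, so its derivative integrates
  -- to 1. The factor 4 is the diameter of the ball, and convexity keeps the segment inside.
  have hseg : ∀ x ∈ S, ∀ y ∈ T, (1 : ENNReal) ≤ 4 * ∫⁻ s in Icc (0 : ℝ) 1, K' (x + s • (y - x)) := by
    intro x hx y hy
    have hmem : ∀ s ∈ Icc (0 : ℝ) 1, x + s • (y - x) ∈ B := fun s hs =>
      (convex_ball (0 : Space n) 2).add_smul_sub_mem hx.1 hy.1 hs
    have hd : ∀ s, HasDerivAt (fun s : ℝ => step k (U (x + s • (y - x))))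
        (stepDeriv k (U (x + s • (y - x))) * fderiv ℝ U (x + s • (y - x)) (y - x)) s := by
      intro s
      have h1 : HasDerivAt (fun s : ℝ => x + s • (y - x)) (y - x) s := by
        simpa using ((hasDerivAt_id s).smul_const (y - x)).const_add x
      exact (hasDerivAt_step k _).comp s
        ((hU.differentiable one_ne_zero _).hasFDerivAt.comp_hasDerivAt s h1)
    have hdU : Continuous (fderiv ℝ U) := hU.continuous_fderiv one_ne_zero
    have hint := intervalIntegral.integral_eq_sub_of_hasDerivAt (a := 0) (b := 1) (fun s _ => hd s)
      (Continuous.intervalIntegrable (by fun_prop) _ _)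
    simp only [one_smul, add_sub_cancel, zero_smul, add_zero] at hint
    rw [step_of_nonpos k hx.2, step_of_one_le k hy.2, sub_zero,
      intervalIntegral.integral_of_le (zero_le_one' ℝ), ← integral_Icc_eq_integral_Ioc] at hint
    have hxy : ‖y - x‖ ≤ 4 := by
      have h1 : ‖x‖ < 2 := by simpa [hB] using hx.1
      have h2 : ‖y‖ < 2 := by simpa [hB] using hy.1
      linarith [norm_sub_le y x]
    have hle : (1 : ℝ) ≤ 4 * ∫ s in Icc (0 : ℝ) 1, K (x + s • (y - x)) := by
      refine hint.symm.le.trans ?_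
      rw [← integral_const_mul]
      refine setIntegral_mono_on ?_ ?_ measurableSet_Icc fun s hs => ?_
      · exact (Continuous.continuousOn (by fun_prop)).integrableOn_compact isCompact_Icc
      · exact (Continuous.continuousOn (by fun_prop)).integrableOn_compact isCompact_Icc
      · have h1 := (le_abs_self _).trans (hg _ (hmem s hs) (y - x))
        have h2 : G (x + s • (y - x)) * ‖y - x‖ ≤ G (x + s • (y - x)) * 4 :=
          mul_le_mul_of_nonneg_left hxy (hG0 _)
        have h3 := mul_le_mul_of_nonneg_left (h1.trans h2)
          (stepDeriv_nonneg k (U (x + s • (y - x))))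
        simp only [hKdef]; linarith
    have h4 : ENNReal.ofReal 1 ≤ ENNReal.ofReal (4 * ∫ s in Icc (0 : ℝ) 1, K (x + s • (y - x))) :=
      ENNReal.ofReal_le_ofReal hle
    rw [ENNReal.ofReal_one, ENNReal.ofReal_mul (by norm_num), ofReal_integral_eq_lintegral_ofReal
      ((Continuous.continuousOn (by fun_prop)).integrableOn_compact isCompact_Icc)
      (Filter.Eventually.of_forall fun s => hK0 _)] at h4
    refine h4.trans (le_of_eq ?_)
    congr 1
    · norm_num
    · refine setLIntegral_congr_fun measurableSet_Icc fun s hs => ?_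
      simp only [hK', indicator_of_mem (hmem s hs)]
  have hBfin : volume B ≠ ⊤ := measure_ball_lt_top.ne
  have hSm : MeasurableSet S := Metric.isOpen_ball.measurableSet.inter
    (measurableSet_le hUc.measurable measurable_const)
  have hTm : MeasurableSet T := Metric.isOpen_ball.measurableSet.inter
    (measurableSet_le measurable_const hUc.measurable)
  have hmain : volume S * volume T ≤ 4 * (2 ^ n * volume B * ∫⁻ y, K' y) := by
    calc volume S * volume T = ∫⁻ x in S, ∫⁻ y in T, 1 := by
          simp only [lintegral_const, Measure.restrict_apply_univ, one_mul, mul_comm]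
      _ ≤ ∫⁻ x in S, ∫⁻ y in T, 4 * ∫⁻ s in Icc (0 : ℝ) 1, K' (x + s • (y - x)) :=
          setLIntegral_mono' hSm fun x hx => setLIntegral_mono' hTm fun y hy => hseg x hx y hy
      _ = 4 * ∫⁻ x in S, ∫⁻ y in T, ∫⁻ s in Icc (0 : ℝ) 1, K' (x + s • (y - x)) := by
          simp_rw [lintegral_const_mul' 4 _ (by norm_num : (4 : ENNReal) ≠ ⊤)]
      _ ≤ _ := by
          gcongr
          exact lintegral_segment_le hK'm (measure_mono inter_subset_left)
            (measure_mono inter_subset_left)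
  have hKi : IntegrableOn K B :=
    (hKc.continuousOn.integrableOn_compact (isCompact_closedBall (0 : Space n) 2)).mono_set
      Metric.ball_subset_closedBall
  rw [hK', lintegral_indicator Metric.isOpen_ball.measurableSet,
    ← ofReal_integral_eq_lintegral_ofReal hKi (Filter.Eventually.of_forall hK0)] at hmain
  have hI0 : 0 ≤ ∫ x in B, K x := integral_nonneg hK0
  have := ENNReal.toReal_mono (by finiteness) hmain
  simp only [ENNReal.toReal_mul, ENNReal.toReal_pow, ENNReal.toReal_ofNat,
    ENNReal.toReal_ofReal hI0] at this
  simp only [Measure.real]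
  linarith

/-! ### The one-dimensional argument in time -/

lemma setIntegral_le_of_le_indicator {g : ℝ → ℝ} {ε V c d : ℝ} (hcd : c ≤ d) {N S : Set ℝ}
    (hN : MeasurableSet N) (hS : MeasurableSet S) (hg : IntegrableOn g (Icc c d))
    (h : ∀ t ∈ Icc c d, g t ≤ ε + N.indicator (fun _ => V) t + S.indicator (fun _ => V) t) :
    ∫ t in Icc c d, g t ≤ ε * (d - c) + V * volume.real (N ∩ Icc c d)
      + V * volume.real (S ∩ Icc c d) := by
  have iN : IntegrableOn (N.indicator fun _ : ℝ => V) (Icc c d) :=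
    (integrable_const V).indicator hN
  have iS : IntegrableOn (S.indicator fun _ : ℝ => V) (Icc c d) :=
    (integrable_const V).indicator hS
  have i0 : IntegrableOn (fun _ : ℝ => ε) (Icc c d) := integrable_const ε
  have i1 : IntegrableOn (fun t => ε + N.indicator (fun _ => V) t) (Icc c d) := i0.add iN
  refine (setIntegral_mono_on hg (i1.add iS) measurableSet_Icc h).trans (le_of_eq ?_)
  simp only [Pi.add_apply]
  rw [integral_add i1 iS, integral_add i0 iN, integral_indicator_const _ hN,
    integral_indicator_const _ hS, setIntegral_const, Real.volume_real_Icc_of_le hcd]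
  simp only [Measure.real, Measure.restrict_apply hN, Measure.restrict_apply hS, smul_eq_mul]
  ring

/-- A quantity which controls `A` and `B` and cannot increase quickly prevents a transition from
`B = 0` to `A = 0`, when `A B` and `C` are small in average. -/
lemma no_transition {V L v₁ ω τ δ₀ ε κ κ' θ a b : ℝ} (hV : 0 < V) (hL : 0 ≤ L)
    (hε : 0 < ε) (h1 : ω + (2 * L + 2) * ε < v₁) (hθ : κ / ε + κ' / ε ^ 2 ≤ θ) (h2 : θ < τ / 2)
    (h3 : 4 * ε + V * θ + κ < δ₀ / 4) (hκ : 0 ≤ κ) (hκ' : 0 ≤ κ')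
    (hab : a ≤ b) (ha : -4 ≤ a) (hb : b ≤ 0)
    {A B C W : ℝ → ℝ} (hA : Measurable A) (hB : Measurable B) (hC : Measurable C)
    (hA0 : ∀ t, 0 ≤ A t) (hB0 : ∀ t, 0 ≤ B t) (hC0 : ∀ t, 0 ≤ C t)
    (hAV : ∀ t, A t ≤ V) (hBV : ∀ t, B t ≤ V) (hCV : ∀ t, C t ≤ V)
    (hWle : ∀ t ∈ Icc a b, W t ≤ L * (B t + C t))
    (hWge : ∀ t ∈ Icc a b, v₁ - A t - C t ≤ W t)
    (hW : ∀ s t, a ≤ s → s ≤ t → t ≤ b → t - s ≤ τ → W t - W s ≤ ω)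
    (hAB : ∫ t in Icc a b, A t * B t ≤ κ') (hCκ : ∫ t in Icc a b, C t ≤ κ)
    (hAint : 2 * V - κ ≤ ∫ t in Icc a b, A t)
    (hBint : δ₀ - κ ≤ ∫ t in Icc (max a (-2)) b, B t) : False := by
  have hbdd : ∀ {g : ℝ → ℝ} {R : ℝ}, Measurable g → (∀ t, 0 ≤ g t) → (∀ t, g t ≤ R) → ∀ c d,
      IntegrableOn g (Icc c d) := fun {g R} hg h0 hR c d =>
    Measure.integrableOn_of_bounded (M := R) (by simp) hg.aestronglyMeasurable
      (Filter.Eventually.of_forall fun t => by rw [Real.norm_of_nonneg (h0 t)]; exact hR t)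
  have hθ0 : 0 ≤ θ := le_trans (by positivity) hθ
  have hVθ : 0 ≤ V * θ := mul_nonneg hV.le hθ0
  -- The exceptional times. Chebyshev bounds their measure by κ/ε + κ'/ε² ≤ θ; at every other time C
  -- < ε and one of A, B is at most ε.
  set N : Set ℝ := {t | ε ≤ C t} ∪ {t | ε ^ 2 ≤ A t * B t} with hNdef
  have hNm : MeasurableSet N := (measurableSet_le measurable_const hC).union
    (measurableSet_le measurable_const (hA.mul hB))
  have hNθ : volume.real (N ∩ Icc a b) ≤ θ := by
    have m1 := mul_meas_ge_le_integral_of_nonneg (μ := volume.restrict (Icc a b))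
      (Filter.Eventually.of_forall hC0) (hbdd hC hC0 hCV a b) ε
    have m2 := mul_meas_ge_le_integral_of_nonneg (μ := volume.restrict (Icc a b))
      (f := fun t => A t * B t) (Filter.Eventually.of_forall fun t => mul_nonneg (hA0 t) (hB0 t))
      (hbdd (hA.mul hB) (fun t => mul_nonneg (hA0 t) (hB0 t))
        (fun t => mul_le_mul (hAV t) (hBV t) (hB0 t) hV.le) a b) (ε ^ 2)
    have m3 : (volume.restrict (Icc a b)).real {t | ε ≤ C t} ≤ κ / ε := by
      rw [le_div_iff₀ hε]; linarith
    have m4 : (volume.restrict (Icc a b)).real {t | ε ^ 2 ≤ A t * B t} ≤ κ' / ε ^ 2 := by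
      rw [le_div_iff₀ (by positivity)]; linarith
    have m5 := measureReal_union_le (μ := volume.restrict (Icc a b)) {t | ε ≤ C t}
      {t | ε ^ 2 ≤ A t * B t}
    rw [← hNdef, measureReal_restrict_apply hNm] at m5
    linarith
  have hNC : ∀ t, t ∉ N → C t < ε := fun t ht => by
    by_contra h; exact ht (Or.inl (not_lt.1 h))
  have hNAB : ∀ t, t ∉ N → A t ≤ ε ∨ B t ≤ ε := fun t ht => by
    by_contra! h
    refine ht (Or.inr ?_)
    show ε ^ 2 ≤ A t * B t
    nlinarith [h.1, h.2]
  -- Here W s ≤ 2Lε while W t ≥ v₁ - 2ε, a rise larger than ω.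
  have hjump : ∀ s t, a ≤ s → s ≤ t → t ≤ b → t - s ≤ τ → s ∉ N → t ∉ N → B s ≤ ε → A t ≤ ε →
      False := by
    intro s t has hst htb hτ hs ht hBs hAt
    have w1 := hWle s ⟨has, hst.trans htb⟩
    have w2 := hWge t ⟨has.trans hst, htb⟩
    have w3 := hW s t has hst htb hτ
    have w4 := hNC s hs
    have w5 := hNC t ht
    have w6 : L * (B s + C s) ≤ L * (2 * ε) := mul_le_mul_of_nonneg_left (by linarith) hL
    linarith
  -- a late time at which `A` is small
  obtain ⟨t₀, ht₀, ht₀N, ht₀A, ht₀δ⟩ : ∃ t₀ ∈ Icc a b, t₀ ∉ N ∧ A t₀ ≤ ε ∧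
      -2 + δ₀ / (4 * V) ≤ t₀ := by
    -- Otherwise B ≤ ε at every good time after -2 + δ₀/(4V). Bounding B by V on N and on the
    -- initial piece gives ∫B ≤ 2ε + Vθ + δ₀/4, which is less than δ₀ - κ.
    by_contra! hcon
    have hVδ : V * (δ₀ / (4 * V)) = δ₀ / 4 := by field_simp
    have hδ0 : 0 ≤ δ₀ / (4 * V) := by
      have : 0 < δ₀ := by linarith
      positivity
    rcases le_or_gt (max a (-2)) b with hcd | hcd
    · have := setIntegral_le_of_le_indicator (ε := ε) (V := V) hcd hNm
        (measurableSet_Iio (a := -2 + δ₀ / (4 * V))) (hbdd hB hB0 hBV _ _) (fun t ht => by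
          have htab : t ∈ Icc a b := ⟨(le_max_left _ _).trans ht.1, ht.2⟩
          have n1 : 0 ≤ N.indicator (fun _ => V) t := indicator_nonneg (fun _ _ => hV.le) _
          have n2 : 0 ≤ (Iio (-2 + δ₀ / (4 * V))).indicator (fun _ => V) t :=
            indicator_nonneg (fun _ _ => hV.le) _
          by_cases hN : t ∈ N
          · rw [indicator_of_mem hN]; linarith [hBV t]
          by_cases hS : t ∈ Iio (-2 + δ₀ / (4 * V))
          · rw [indicator_of_mem hS]; linarith [hBV t]
          rcases hNAB t hN with h | h
          · exact absurd (hcon t htab hN h) (by simpa using hS)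
          · linarith)
      have e1 : volume.real (N ∩ Icc (max a (-2)) b) ≤ θ := by
        refine le_trans (measureReal_mono ?_ ?_) hNθ
        · exact inter_subset_inter_right _ (Icc_subset_Icc_left (le_max_left _ _))
        · exact ((measure_mono inter_subset_right).trans_lt measure_Icc_lt_top).ne
      have e2 : volume.real (Iio (-2 + δ₀ / (4 * V)) ∩ Icc (max a (-2)) b)
          ≤ δ₀ / (4 * V) := by
        have : volume.real (Ico (-2) (-2 + δ₀ / (4 * V))) = δ₀ / (4 * V) := by
          rw [Real.volume_real_Ico_of_le (by linarith)]; ring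
        refine le_trans (measureReal_mono (fun t ht => ?_) (by simp)) this.le
        exact ⟨(le_max_right _ _).trans ht.2.1, ht.1⟩
      have e3 : b - max a (-2) ≤ 2 := by linarith [le_max_right a (-2)]
      have e4 : ε * (b - max a (-2)) ≤ ε * 2 := mul_le_mul_of_nonneg_left e3 hε.le
      have e5 := mul_le_mul_of_nonneg_left e1 hV.le
      have e6 := mul_le_mul_of_nonneg_left e2 hV.le
      linarith
    · rw [Icc_eq_empty (not_le.2 hcd), Measure.restrict_empty, integral_zero_measure] at hBint
      linarith
  have hVδ : V * (δ₀ / (4 * V)) = δ₀ / 4 := by field_simp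
  -- an earlier time at which `B` is small
  set Z : Set ℝ := {t | t ∈ Icc a t₀ ∧ t ∉ N ∧ B t ≤ ε} with hZ
  have hZne : Z.Nonempty := by
    -- Otherwise A ≤ ε at every good time up to t₀, so ∫A ≤ 4ε + Vθ + V(b - t₀). Since V(b - t₀) ≤
    -- 2V - δ₀/4, this is less than 2V - κ. The lower bound on t₀ is used here.
    by_contra hcon
    rw [not_nonempty_iff_eq_empty] at hcon
    have := setIntegral_le_of_le_indicator (ε := ε) (V := V) hab hNm
      (measurableSet_Ioi (a := t₀)) (hbdd hA hA0 hAV _ _) (fun t ht => by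
        have n1 : 0 ≤ N.indicator (fun _ => V) t := indicator_nonneg (fun _ _ => hV.le) _
        have n2 : 0 ≤ (Ioi t₀).indicator (fun _ => V) t := indicator_nonneg (fun _ _ => hV.le) _
        by_cases hN : t ∈ N
        · rw [indicator_of_mem hN]; linarith [hAV t]
        by_cases hS : t ∈ Ioi t₀
        · rw [indicator_of_mem hS]; linarith [hAV t]
        rcases hNAB t hN with h | h
        · linarith
        · have : t ∈ Z := ⟨⟨ht.1, by simpa using hS⟩, hN, h⟩
          rw [hcon] at this
          exact absurd this (notMem_empty _))
    have e2 : volume.real (Ioi t₀ ∩ Icc a b) ≤ b - t₀ := by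
      rw [← Real.volume_real_Ioc_of_le ht₀.2]
      exact measureReal_mono (fun t ht => ⟨ht.1, ht.2.2⟩) (by simp)
    have e4 : ε * (b - a) ≤ ε * 4 := mul_le_mul_of_nonneg_left (by linarith) hε.le
    have e5 := mul_le_mul_of_nonneg_left hNθ hV.le
    have e6 := mul_le_mul_of_nonneg_left e2 hV.le
    have e7 : V * (b - t₀) ≤ V * (2 - δ₀ / (4 * V)) :=
      mul_le_mul_of_nonneg_left (by linarith) hV.le
    rw [mul_sub V 2, hVδ] at e7
    linarith
  have hZbdd : BddAbove Z := ⟨t₀, fun t ht => ht.1.2⟩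
  set σ := sSup Z with hσ
  have hτ : 0 < τ := by linarith
  obtain ⟨s, hs, hsσ⟩ := exists_lt_of_lt_csSup hZne (show σ - τ / 4 < σ by linarith)
  have hsσ' : s ≤ σ := le_csSup hZbdd hs
  have hσt₀ : σ ≤ t₀ := csSup_le hZne fun t ht => ht.1.2
  -- A good time just after σ cannot have B ≤ ε, as σ is the supremum, nor A ≤ ε, as W would jump
  -- from s. So this interval consists of exceptional times and is no longer than θ < τ/2, which
  -- forces t₀ < σ + τ/2 and a forbidden jump from s to t₀.
  have hsub : Ioo σ (min (σ + τ / 2) t₀) ⊆ N ∩ Icc a b := by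
    intro t ht
    have ht1 : t < σ + τ / 2 := ht.2.trans_le (min_le_left _ _)
    have ht2 : t < t₀ := ht.2.trans_le (min_le_right _ _)
    have hat : a ≤ t := by linarith [hs.1.1, ht.1]
    refine ⟨?_, hat, by linarith [ht₀.2]⟩
    by_contra hN
    rcases hNAB t hN with h | h
    · exact hjump s t hs.1.1 (by linarith [ht.1]) (by linarith [ht₀.2]) (by linarith) hs.2.1 hN
        hs.2.2 h
    · have := le_csSup hZbdd (show t ∈ Z from ⟨⟨hat, ht2.le⟩, hN, h⟩)
      linarith [ht.1]
  have hlen : min (σ + τ / 2) t₀ - σ ≤ θ := by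
    have h5 := measureReal_mono (μ := volume) hsub
      ((measure_mono inter_subset_right).trans_lt measure_Icc_lt_top).ne
    rw [Real.volume_real_Ioo_of_le (le_min (by linarith) hσt₀)] at h5
    linarith
  rcases le_total (σ + τ / 2) t₀ with h | h
  · rw [min_eq_left h] at hlen; linarith
  · exact hjump s t₀ hs.1.1 (by linarith) ht₀.2 (by linarith) hs.2.1 ht₀N hs.2.2 ht₀A

/-! ### Slice measures, the source term and bounds on the mass -/

lemma measurable_volume_section {S : Set (ℝ × Space n)} (hS : MeasurableSet S) :
    Measurable fun t => volume.real (Prod.mk t ⁻¹' S) :=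
  (measurable_measure_prodMk_left hS).ennreal_toReal

lemma integral_volume_section {S : Set (ℝ × Space n)} (hS : MeasurableSet S)
    (hfin : ∀ t, volume (Prod.mk t ⁻¹' S) < ⊤) (c d : ℝ) :
    ∫ t in Icc c d, volume.real (Prod.mk t ⁻¹' S) = volume.real (S ∩ Icc c d ×ˢ univ) := by
  simp only [Measure.real]
  rw [integral_toReal (measurable_measure_prodMk_left hS).aemeasurable
    (Filter.Eventually.of_forall hfin), ← Measure.prod_apply hS]
  congr 1
  rw [← Measure.restrict_apply hS, Measure.volume_eq_prod, ← Measure.prod_restrict,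
    Measure.restrict_univ]

/-- Uniform integrability: Young's inequality trades |f| for η|f|^m + C, so the integral over a time
interval is a small constant plus a multiple of its length. A modulus of continuity uniform in f
follows. -/
lemma integral_abs_le {m K a b : ℝ} (hm : 1 < m) {η C : ℝ} (hη : 0 ≤ η)
    (hC : ∀ x : ℝ, 0 ≤ x → x ≤ η * x ^ m + C) {f : ℝ × Space n → ℝ} (hf : Continuous f)
    (hfK : ∫ z in slab n a b, |f z| ^ m ≤ K) {s t : ℝ} (has : a ≤ s) (hst : s ≤ t) (htb : t ≤ b) :
    ∫ r in Ioc s t, ∫ x in Metric.closedBall (0 : Space n) (5 / 2), |f (r, x)|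
      ≤ η * K + C * volume.real (Metric.closedBall (0 : Space n) (5 / 2)) * (t - s) := by
  set B := Metric.closedBall (0 : Space n) (5 / 2) with hB
  have hfm : Continuous fun z => |f z| ^ m := hf.abs.rpow_const fun _ => Or.inr (by linarith)
  have i1 := Continuous.integrable_slab (k := fun z => |f z|) (by fun_prop) s t
  have i2 := Continuous.integrable_slab hfm s t
  have i3 : Integrable (fun z => η * |f z| ^ m + C)
    ((volume.restrict (Ioc s t)).prod (volume.restrict B)) := (i2.const_mul η).add
      (Continuous.integrable_slab (k := fun _ => C) (by fun_prop) s t)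
  rw [← integral_prod (fun z => |f z|) i1]
  refine (integral_mono i1 i3 fun z => hC _ (abs_nonneg _)).trans ?_
  rw [integral_add (i2.const_mul η)
    (Continuous.integrable_slab (k := fun _ => C) (by fun_prop) s t), integral_const_mul]
  have e1 : ∫ z, |f z| ^ m ∂((volume.restrict (Ioc s t)).prod (volume.restrict B)) ≤ K := by
    refine le_trans ?_ hfK
    rw [Measure.prod_restrict, ← Measure.volume_eq_prod]
    refine setIntegral_mono_set ?_ (Filter.Eventually.of_forall fun z => by positivity)
      (Filter.Eventually.of_forall (prod_mono (fun r hr => ⟨has.trans hr.1.le, hr.2.trans htb⟩)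
        le_rfl))
    exact hfm.continuousOn.integrableOn_compact (isCompact_Icc.prod (isCompact_closedBall _ _))
  have e2 : ∫ _ : ℝ × Space n, C ∂((volume.restrict (Ioc s t)).prod (volume.restrict B))
      = C * volume.real B * (t - s) := by
    rw [integral_const, smul_eq_mul, Measure.prod_restrict, measureReal_restrict_apply_univ,
      measureReal_prod_prod, Real.volume_real_Ioc_of_le hst]
    ring
  rw [e2]
  have := mul_le_mul_of_nonneg_left e1 hη
  linarith

lemma mass_nonneg (k : ℕ) (ξ : Space n → ℝ) (u : ℝ × Space n → ℝ) (t : ℝ) : 0 ≤ mass k ξ u t :=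
  integral_nonneg fun _ => mul_nonneg (posPow_nonneg _ _) (sq_nonneg _)

/-- The integrand is at most M^(k+3) and vanishes off S. With `le_mass`, this turns the mass into
information on the slice measures, as `no_transition` requires. -/
lemma mass_le {k : ℕ} {ξ : ContDiffBump (0 : Space n)} {u : ℝ × Space n → ℝ} (hu : Continuous u)
    {M t : ℝ} (hM : 0 ≤ M) {S : Set (Space n)} (hS : MeasurableSet S)
    (hSB : S ⊆ Metric.closedBall (0 : Space n) (5 / 2))
    (hle : ∀ x ∈ Metric.closedBall (0 : Space n) (5 / 2), u (t, x) ≤ M)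
    (hS0 : ∀ x ∈ Metric.closedBall (0 : Space n) (5 / 2), x ∉ S → u (t, x) ≤ 0 ∨ ξ x = 0) :
    mass k ξ u t ≤ M ^ (k + 3) * volume.real S := by
  have hξc := ξ.continuous
  have hc : IsCompact (Metric.closedBall (0 : Space n) (5 / 2)) := isCompact_closedBall _ _
  have e : M ^ (k + 3) * volume.real S
      = ∫ x in Metric.closedBall (0 : Space n) (5 / 2), S.indicator (fun _ => M ^ (k + 3)) x := by
    rw [integral_indicator_const _ hS, measureReal_restrict_apply hS, inter_eq_left.2 hSB,
      smul_eq_mul, mul_comm]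
  rw [e]
  refine setIntegral_mono_on (ContinuousOn.integrableOn_compact hc (Continuous.continuousOn
    (by fun_prop))) ?_ measurableSet_closedBall fun x hx => ?_
  · have : IsFiniteMeasure (volume.restrict (Metric.closedBall (0 : Space n) (5 / 2))) :=
      ⟨by simpa using hc.measure_lt_top⟩
    exact (integrable_const _).indicator hS
  by_cases h : x ∈ S
  · rw [indicator_of_mem h]
    have h1 : posPow (k + 3) (u (t, x)) ≤ M ^ (k + 3) := by
      rw [← posPow_of_nonneg _ hM]; exact posPow_mono _ (hle x hx)
    have h2 : ξ x ^ 2 ≤ 1 := pow_le_one₀ ξ.nonneg ξ.le_one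
    calc _ ≤ posPow (k + 3) (u (t, x)) * 1 := mul_le_mul_of_nonneg_left h2 (posPow_nonneg _ _)
      _ ≤ _ := by linarith
  · rw [indicator_of_notMem h]
    rcases hS0 x hx h with h' | h'
    · rw [posPow_of_nonpos (by omega) h', zero_mul]
    · simp [h']

lemma le_mass {k : ℕ} {ξ : ContDiffBump (0 : Space n)} {u : ℝ × Space n → ℝ} (hu : Continuous u)
    {t : ℝ} {S : Set (Space n)} (hS : MeasurableSet S)
    (hSB : S ⊆ Metric.closedBall (0 : Space n) (5 / 2)) (hS1 : ∀ x ∈ S, 1 ≤ u (t, x) ∧ ξ x = 1) :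
    volume.real S ≤ mass k ξ u t := by
  have hξc := ξ.continuous
  have hc : IsCompact (Metric.closedBall (0 : Space n) (5 / 2)) := isCompact_closedBall _ _
  have e : volume.real S
      = ∫ x in Metric.closedBall (0 : Space n) (5 / 2), S.indicator (fun _ => (1 : ℝ)) x := by
    rw [integral_indicator_const _ hS, measureReal_restrict_apply hS, inter_eq_left.2 hSB,
      smul_eq_mul, mul_one]
  rw [e]
  refine setIntegral_mono_on ?_ (ContinuousOn.integrableOn_compact hc (Continuous.continuousOn
    (by fun_prop))) measurableSet_closedBall fun x hx => ?_
  · have : IsFiniteMeasure (volume.restrict (Metric.closedBall (0 : Space n) (5 / 2))) :=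
      ⟨by simpa using hc.measure_lt_top⟩
    exact (integrable_const _).indicator hS
  by_cases h : x ∈ S
  · rw [indicator_of_mem h, (hS1 x h).2, one_pow, mul_one]
    exact one_le_posPow _ (hS1 x h).1
  · rw [indicator_of_notMem h]
    exact mul_nonneg (posPow_nonneg _ _) (sq_nonneg _)

/-- Young's inequality with weight stepDeriv ≤ 2β'. As stepDeriv vanishes off (0, 1), the constant
is charged only to the intermediate set. -/
lemma stepDeriv_mul_le {p d C : ℝ} (hd : 0 ≤ d) (hC0 : 0 ≤ C)
    (hC : ∀ x : ℝ, 0 ≤ x → x ≤ d * x ^ p + C) {k : ℕ}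
    {r x : ℝ} (hx : 0 ≤ x) :
    stepDeriv k r * x ≤ 2 * d * (((k + 3) * posPow (k + 2) r) * x ^ p)
      + {r : ℝ | 0 < r ∧ r < 1}.indicator (fun _ => 2 * (k + 3) * C) r := by
  have h0 := posPow_nonneg (k + 2) r
  by_cases hr : 0 < r ∧ r < 1
  · rw [indicator_of_mem (show r ∈ {r : ℝ | 0 < r ∧ r < 1} from hr)]
    have h1 := stepDeriv_le k r
    have h2 : posPow (k + 2) r ≤ 1 := by
      rw [posPow_of_nonneg _ hr.1.le]; exact pow_le_one₀ hr.1.le hr.2.le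
    have h3 : stepDeriv k r * x ≤ 2 * ((k + 3) * posPow (k + 2) r) * (d * x ^ p + C) :=
      mul_le_mul h1 (hC x hx) hx (by positivity)
    have h4 : 2 * ((k + 3) * posPow (k + 2) r) * C ≤ 2 * ((k + 3) * 1) * C := by gcongr
    linarith
  · rw [indicator_of_notMem (show r ∉ {r : ℝ | 0 < r ∧ r < 1} from hr), stepDeriv_eq_zero k hr]
    have : 0 ≤ x ^ p := by positivity
    simp only [zero_mul, add_zero]
    positivity

/-- The isoperimetric inequality on a time slice of a classical subsolution. -/
lemma slice_isoperimetric {c Λ M p a b : ℝ} {u f G : ℝ × Space n → ℝ} {F : ℝ × Space n → Space n}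
    (hp : 0 ≤ p) (h : IsClassicalSubsolution c Λ M p a b u f G F) {d C : ℝ} (hd : 0 ≤ d)
    (hC0 : 0 ≤ C)
    (hC : ∀ x : ℝ, 0 ≤ x → x ≤ d * x ^ p + C) (k : ℕ) {ξ : ContDiffBump (0 : Space n)}
    (hξ : ξ.rIn = 2) {t : ℝ} (ht : t ∈ Icc a b) :
    volume.real (Metric.ball (0 : Space n) 2 ∩ {x | u (t, x) ≤ 0})
      * volume.real (Metric.ball (0 : Space n) 2 ∩ {x | 1 ≤ u (t, x)})
    ≤ 4 * (2 ^ n * volume.real (Metric.ball (0 : Space n) 2))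
      * (2 * d * (∫ x in Metric.closedBall (0 : Space n) (5 / 2), dissip k p ξ u G (t, x))
        + 2 * (k + 3) * C *
          volume.real (Metric.ball (0 : Space n) 2 ∩ {x | 0 < u (t, x) ∧ u (t, x) < 1})) := by
  have hu := h.contDiff_u
  have hG := h.continuous_G
  have huc := hu.continuous
  have hξc := ξ.continuous
  have hdis := continuous_dissip (k := k) (p := p) hp hξc huc hG
  set B := Metric.ball (0 : Space n) 2 with hB
  have hBB : B ⊆ Metric.closedBall (0 : Space n) (5 / 2) :=
    Metric.ball_subset_closedBall.trans (Metric.closedBall_subset_closedBall (by norm_num))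
  have hc : IsCompact (Metric.closedBall (0 : Space n) (5 / 2)) := isCompact_closedBall _ _
  have hmem : ∀ x ∈ B, (t, x) ∈ slab n a b := fun x hx => ⟨ht, hBB hx⟩
  have hder : ∀ x, fderiv ℝ (fun x => u (t, x)) x =
      (fderiv ℝ u (t, x)).comp (ContinuousLinearMap.inr ℝ ℝ (Space n)) := fun x =>
    ((hu.differentiable one_ne_zero (t, x)).hasFDerivAt.comp x (hasFDerivAt_prodMk_right t x)).fderiv
  refine (volume_mul_volume_le (k := k) (U := fun x => u (t, x)) (G := fun x => G (t, x))
    (by fun_prop) (by fun_prop) (fun x => h.nonneg_G _) (fun x hx v => ?_)).trans ?_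
  · rw [hder]; exact h.grad_le _ (hmem x hx) v
  refine mul_le_mul_of_nonneg_left ?_ (by positivity)
  set S : Set (Space n) := {x | 0 < u (t, x) ∧ u (t, x) < 1} with hS
  have hSm : MeasurableSet S := (measurableSet_lt measurable_const
    (by fun_prop : Continuous fun x => u (t, x)).measurable).inter (measurableSet_lt
    (by fun_prop : Continuous fun x => u (t, x)).measurable measurable_const)
  have hfinB : IsFiniteMeasure (volume.restrict B) :=
    ⟨by simpa using (measure_mono hBB).trans_lt hc.measure_lt_top⟩
  have i1 : ∀ {q : Space n → ℝ}, Continuous q → IntegrableOn q B := fun hq =>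
    (hq.continuousOn.integrableOn_compact hc).mono_set hBB
  have i2 : IntegrableOn (S.indicator fun _ => 2 * (k + 3) * C) B :=
    (integrable_const _).indicator hSm
  have i3 : IntegrableOn (fun x => 2 * d * dissip k p ξ u G (t, x)) B := i1 (by fun_prop)
  calc ∫ x in B, stepDeriv k (u (t, x)) * G (t, x)
      ≤ ∫ x in B, (2 * d * dissip k p ξ u G (t, x) + S.indicator (fun _ => 2 * (k + 3) * C) x) := by
        refine setIntegral_mono_on (i1 (by fun_prop)) (i3.add i2)
          Metric.isOpen_ball.measurableSet fun x hx => ?_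
        have := stepDeriv_mul_le hd hC0 hC (k := k) (r := u (t, x)) (h.nonneg_G (t, x))
        have hξ1 : ξ x = 1 := ξ.one_of_mem_closedBall (by
          rw [hξ]; exact Metric.ball_subset_closedBall hx)
        simp only [dissip, hξ1, one_pow, mul_one]
        exact this
    _ = 2 * d * (∫ x in B, dissip k p ξ u G (t, x)) + 2 * (k + 3) * C * volume.real (B ∩ S) := by
        rw [integral_add i3 i2, integral_const_mul, integral_indicator_const _ hSm,
          measureReal_restrict_apply hSm, smul_eq_mul, inter_comm S B, mul_comm (volume.real _)]
    _ ≤ _ := by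
        gcongr
        · exact Filter.Eventually.of_forall fun x => mul_nonneg (mul_nonneg (mul_nonneg
            (by positivity) (posPow_nonneg _ _)) (sq_nonneg _)) (Real.rpow_nonneg (h.nonneg_G _) _)
        · exact (show Continuous fun x => dissip k p ξ u G (t, x) by
            fun_prop).continuousOn.integrableOn_compact hc

/-! ### The intermediate value lemma for classical subsolutions -/

/-- The intermediate value lemma for classical subsolutions, with room in the hypotheses. -/
theorem exists_intermediate_measure (n : ℕ) {p m c Λ M K δ₀ : ℝ} (hp : 2 < p) (hm : 1 < m)
    (hc : 0 < c) (hΛ : 0 < Λ) (hM : 1 ≤ M) (hK : 0 ≤ K) (hδ₀ : 0 < δ₀) :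
    ∃ κ : ℝ, 0 < κ ∧ ∀ a b : ℝ, -4 ≤ a → a ≤ b → b ≤ 0 →
      ∀ (u f G : ℝ × Space n → ℝ) (F : ℝ × Space n → Space n),
      IsClassicalSubsolution c Λ M p a b u f G F → ∫ z in slab n a b, |f z| ^ m ≤ K →
      2 * volume.real (Metric.ball (0 : Space n) 2) - κ
        ≤ volume.real ({z | u z ≤ 0} ∩ Icc a b ×ˢ Metric.ball (0 : Space n) 2) →
      δ₀ - κ ≤ volume.real ({z | 1 ≤ u z} ∩ Icc (max a (-2)) b ×ˢ Metric.ball (0 : Space n) 2) →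
      κ ≤ volume.real ({z | 0 < u z ∧ u z < 1} ∩ Icc a b ×ˢ Metric.ball (0 : Space n) 2) := by
  have hM0 : 0 < M := by linarith
  obtain ⟨k, hk⟩ : ∃ k : ℕ, 2 / (p - 2) ≤ k + 1 :=
    ⟨⌈2 / (p - 2)⌉₊, (Nat.le_ceil _).trans (by linarith)⟩
  -- The cutoff ξ₁ is 1 on B_2, so its dissipation controls the isoperimetric term there. The cutoff
  -- ξ₂ is 1 on B_1 and vanishes outside B_2, so its mass is governed by the slice measures in B_2.
  let ξ₁ : ContDiffBump (0 : Space n) := ⟨2, 5 / 2, by norm_num, by norm_num⟩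
  let ξ₂ : ContDiffBump (0 : Space n) := ⟨1, 2, by norm_num, by norm_num⟩
  obtain ⟨C₁, hC₁, h₁⟩ := exists_energy hp hk hM0 hc hΛ ξ₁ le_rfl
  obtain ⟨C₂, hC₂, h₂⟩ := exists_energy hp hk hM0 hc hΛ ξ₂ (by norm_num [ξ₂])
  obtain ⟨Y₁, hY₁, hY₁'⟩ := exists_le_mul_rpow_add hm (zero_lt_one' ℝ)
  set V := volume.real (Metric.ball (0 : Space n) 2) with hV
  set V' := volume.real (Metric.closedBall (0 : Space n) (5 / 2)) with hV'
  set v₁ := volume.real (Metric.ball (0 : Space n) 1) with hv₁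
  have hV0 : 0 < V := by
    rw [hV, measureReal_def]
    exact ENNReal.toReal_pos (Metric.measure_ball_pos _ _ (by norm_num)).ne'
      measure_ball_lt_top.ne
  have hv0 : 0 < v₁ := by
    rw [hv₁, measureReal_def]
    exact ENNReal.toReal_pos (Metric.measure_ball_pos _ _ (by norm_num)).ne'
      measure_ball_lt_top.ne
  have hV'0 : 0 ≤ V' := measureReal_nonneg
  -- Bound on the total dissipation: initial mass plus source, over a time of at most 4.
  set E₀ : ℝ := 2 / c * (M ^ (k + 3) * V' + C₁ * 4 + C₁ * (1 * K + Y₁ * V' * 4)) with hE₀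
  have hE₀0 : 0 ≤ E₀ := by positivity
  -- With this η the L^m part of the source raises the mass by at most v₁/8. The choice of τ below
  -- then limits the part proportional to elapsed time to v₁/4, so the rise over τ stays below ω =
  -- v₁/2.
  set η : ℝ := v₁ / (8 * C₂ * (K + 1)) with hη
  have hη0 : 0 < η := by positivity
  obtain ⟨Y₂, hY₂, hY₂'⟩ := exists_le_mul_rpow_add hm hη0
  set τ : ℝ := v₁ / (4 * (C₂ + C₂ * Y₂ * V')) with hτ
  have hτ0 : 0 < τ := by positivity
  set L : ℝ := M ^ (k + 3) with hL
  have hL0 : 0 ≤ L := by positivity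
  set ε : ℝ := min (v₁ / (8 * (L + 1))) (δ₀ / 64) with hε
  have hε0 : 0 < ε := by positivity
  have hε1 : (2 * L + 2) * ε ≤ v₁ / 4 := by
    have : ε ≤ v₁ / (8 * (L + 1)) := min_le_left _ _
    rw [le_div_iff₀ (by positivity)] at this
    linarith
  have hε2 : ε ≤ δ₀ / 64 := min_le_right _ _
  set θ : ℝ := min (τ / 4) (δ₀ / (16 * V)) with hθ
  have hθ0 : 0 < θ := by positivity
  have hθ1 : θ ≤ τ / 4 := min_le_left _ _
  have hθ2 : V * θ ≤ δ₀ / 16 := by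
    have : θ ≤ δ₀ / (16 * V) := min_le_right _ _
    rw [le_div_iff₀ (by positivity)] at this
    linarith
  -- Chebyshev for A·B uses half of θ; the bound κ ≤ θε/2 below gives the other half to C.
  set κ' : ℝ := θ * ε ^ 2 / 2 with hκ'
  have hκ'0 : 0 < κ' := by positivity
  set P : ℝ := 4 * (2 ^ n * V) with hP
  have hP0 : 0 < P := by positivity
  -- The Young parameter d makes the dissipation part of the averaged isoperimetric bound at most
  -- κ'/2. Only then is Y₃ known, and κ is taken small enough that Y₃ times the intermediate measure
  -- fits in the other half.
  set d : ℝ := κ' / (4 * P * (E₀ + 1)) with hd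
  have hd0 : 0 < d := by positivity
  obtain ⟨Y₃, hY₃, hY₃'⟩ := exists_le_mul_rpow_add (show 1 < p by linarith) hd0
  set κ : ℝ := min (min (θ * ε / 2) (δ₀ / 64)) (κ' / (4 * P * ((k + 3) * Y₃))) with hκ
  have hκ0 : 0 < κ := by positivity
  have hκ1 : κ ≤ θ * ε / 2 := (min_le_left _ _).trans (min_le_left _ _)
  have hκ2 : κ ≤ δ₀ / 64 := (min_le_left _ _).trans (min_le_right _ _)
  have hκ3 : P * (2 * (k + 3) * Y₃ * κ) ≤ κ' / 2 := by
    have : κ ≤ κ' / (4 * P * ((k + 3) * Y₃)) := min_le_right _ _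
    rw [le_div_iff₀ (by positivity)] at this
    linarith
  have hd1 : P * (2 * d * E₀) ≤ κ' / 2 := by
    have : d * (4 * P * (E₀ + 1)) = κ' := by rw [hd]; field_simp
    have : 0 ≤ P * d := by positivity
    linarith
  refine ⟨κ, hκ0, fun a b ha hab hb u f G F h hfK hu0 hu1 => ?_⟩
  by_contra! hlt
  have huc := h.contDiff_u.continuous
  have hξ₁c := ξ₁.continuous
  have hdis := continuous_dissip (k := k) (p := p) (by linarith) hξ₁c huc h.continuous_G
  have hball : MeasurableSet (univ ×ˢ Metric.ball (0 : Space n) 2 : Set (ℝ × Space n)) :=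
    MeasurableSet.univ.prod Metric.isOpen_ball.measurableSet
  set SA : Set (ℝ × Space n) := univ ×ˢ Metric.ball 0 2 ∩ {z | u z ≤ 0} with hSA
  set SB : Set (ℝ × Space n) := univ ×ˢ Metric.ball 0 2 ∩ {z | 1 ≤ u z} with hSB
  set SC : Set (ℝ × Space n) := univ ×ˢ Metric.ball 0 2 ∩ {z | 0 < u z ∧ u z < 1} with hSC
  have hSAm : MeasurableSet SA := hball.inter (measurableSet_le huc.measurable measurable_const)
  have hSBm : MeasurableSet SB := hball.inter (measurableSet_le measurable_const huc.measurable)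
  have hSCm : MeasurableSet SC := hball.inter ((measurableSet_lt measurable_const
    huc.measurable).inter (measurableSet_lt huc.measurable measurable_const))
  have secA : ∀ t, Prod.mk t ⁻¹' SA = Metric.ball 0 2 ∩ {x | u (t, x) ≤ 0} := fun t => by
    ext x; simp [hSA]
  have secB : ∀ t, Prod.mk t ⁻¹' SB = Metric.ball 0 2 ∩ {x | 1 ≤ u (t, x)} := fun t => by
    ext x; simp [hSB]
  have secC : ∀ t, Prod.mk t ⁻¹' SC = Metric.ball 0 2 ∩ {x | 0 < u (t, x) ∧ u (t, x) < 1} :=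
    fun t => by ext x; simp [hSC]
  have hsub : ∀ t (Q : Set (ℝ × Space n)), Prod.mk t ⁻¹' (univ ×ˢ Metric.ball 0 2 ∩ Q)
      ⊆ Metric.ball (0 : Space n) 2 := fun t Q x hx => by simpa using hx.1
  have hfin : ∀ t (Q : Set (ℝ × Space n)), volume (Prod.mk t ⁻¹' (univ ×ˢ Metric.ball 0 2 ∩ Q))
      < ⊤ := fun t Q => (measure_mono (hsub t Q)).trans_lt measure_ball_lt_top
  have hleV : ∀ t (Q : Set (ℝ × Space n)),
      volume.real (Prod.mk t ⁻¹' (univ ×ˢ Metric.ball 0 2 ∩ Q)) ≤ V := fun t Q =>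
    measureReal_mono (hsub t Q) measure_ball_lt_top.ne
  have hsec : ∀ (Q : Set (ℝ × Space n)) (s t : ℝ), (univ ×ˢ Metric.ball 0 2 ∩ Q) ∩ Icc s t ×ˢ univ
      = Q ∩ Icc s t ×ˢ Metric.ball (0 : Space n) 2 := fun Q s t => by
    ext z; simp only [mem_inter_iff, mem_prod, mem_univ, true_and, and_true]; tauto
  have hb2 : Metric.ball (0 : Space n) 2 ⊆ Metric.closedBall 0 (5 / 2) :=
    Metric.ball_subset_closedBall.trans (Metric.closedBall_subset_closedBall (by norm_num))
  have hb1 : Metric.ball (0 : Space n) 1 ⊆ Metric.ball 0 2 := Metric.ball_subset_ball (by norm_num)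
  have hfinS : ∀ Q : Set (Space n), volume (Metric.ball (0 : Space n) 2 ∩ Q) ≠ ⊤ := fun Q =>
    ((measure_mono inter_subset_left).trans_lt measure_ball_lt_top).ne
  have iD := (Continuous.integrable_slab hdis a b).integral_prod_left
  -- the energy bound
  have hE : ∫ r in Ioc a b, ∫ x in Metric.closedBall (0 : Space n) (5 / 2),
      dissip k p ξ₁ u G (r, x) ≤ E₀ := by
    have g1 := h₁ a b u f G F h a b le_rfl hab le_rfl
    have g2 := integral_abs_le hm zero_le_one hY₁' h.continuous_f hfK le_rfl hab le_rfl
    have g3 : mass k ξ₁ u a ≤ M ^ (k + 3) * V' :=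
      mass_le huc hM0.le measurableSet_closedBall le_rfl
        (fun x hx => h.le _ ⟨⟨le_rfl, hab⟩, hx⟩) (fun x hx hx' => absurd hx hx')
    have g4 := mass_nonneg k ξ₁ u b
    have g5 : C₁ * (b - a) ≤ C₁ * 4 := mul_le_mul_of_nonneg_left (by linarith) hC₁.le
    have g6 : Y₁ * V' * (b - a) ≤ Y₁ * V' * 4 :=
      mul_le_mul_of_nonneg_left (by linarith) (by positivity)
    have g7 := mul_le_mul_of_nonneg_left (g2.trans (by linarith :
      1 * K + Y₁ * V' * (b - a) ≤ 1 * K + Y₁ * V' * 4)) hC₁.le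
    rw [hE₀, div_mul_eq_mul_div, le_div_iff₀ hc]
    linarith
  refine no_transition (V := V) (L := L) (v₁ := v₁) (ω := v₁ / 2) (τ := τ) (δ₀ := δ₀) (ε := ε)
    (κ := κ) (κ' := κ') (θ := θ) (a := a) (b := b) (A := fun t => volume.real (Prod.mk t ⁻¹' SA))
    (B := fun t => volume.real (Prod.mk t ⁻¹' SB)) (C := fun t => volume.real (Prod.mk t ⁻¹' SC))
    (W := mass k ξ₂ u) hV0 hL0 hε0 (by linarith) ?_ (by linarith) (by linarith) hκ0.le hκ'0.le hab
    ha hb (measurable_volume_section hSAm) (measurable_volume_section hSBm)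
    (measurable_volume_section hSCm) (fun t => measureReal_nonneg) (fun t => measureReal_nonneg)
    (fun t => measureReal_nonneg) (fun t => hleV t _) (fun t => hleV t _) (fun t => hleV t _)
    ?_ ?_ ?_ ?_ ?_ ?_ ?_
  · have e1 : κ / ε ≤ θ / 2 := by rw [div_le_iff₀ hε0]; linarith
    have e2 : κ' / ε ^ 2 = θ / 2 := by rw [hκ']; field_simp
    linarith
  · intro t ht
    simp only [secB, secC]
    refine (mass_le (S := Metric.ball 0 2 ∩ {x | 0 < u (t, x)}) huc hM0.le ?_
      (inter_subset_left.trans hb2) (fun x hx => h.le _ ⟨ht, hx⟩) ?_).trans ?_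
    · exact Metric.isOpen_ball.measurableSet.inter (measurableSet_lt measurable_const
        (show Continuous fun x => u (t, x) by fun_prop).measurable)
    · intro x _ hx
      by_cases h0 : u (t, x) ≤ 0
      · exact Or.inl h0
      · refine Or.inr (ξ₂.zero_of_le_dist ?_)
        by_contra hd'
        exact hx ⟨by simpa [ξ₂] using hd', not_le.1 h0⟩
    · refine mul_le_mul_of_nonneg_left (le_trans (measureReal_mono ?_ ?_)
        (measureReal_union_le _ _)) hL0
      · rintro x ⟨hx, hx0⟩
        rcases le_or_gt 1 (u (t, x)) with h1 | h1
        · exact Or.inl ⟨hx, h1⟩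
        · exact Or.inr ⟨hx, hx0, h1⟩
      · exact measure_union_ne_top (hfinS _) (hfinS _)
  · intro t ht
    simp only [secA, secC]
    have e1 := le_mass (k := k) (ξ := ξ₂) (S := Metric.ball 0 1 ∩ {x | 1 ≤ u (t, x)}) (t := t) huc
      (Metric.isOpen_ball.measurableSet.inter (measurableSet_le measurable_const
        (show Continuous fun x => u (t, x) by fun_prop).measurable))
      (inter_subset_left.trans (hb1.trans hb2))
      (fun x hx => ⟨hx.2, ξ₂.one_of_mem_closedBall (Metric.ball_subset_closedBall hx.1)⟩)
    have e2 : v₁ ≤ volume.real (Metric.ball (0 : Space n) 1 ∩ {x | 1 ≤ u (t, x)} ∪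
        (Metric.ball (0 : Space n) 2 ∩ {x | u (t, x) ≤ 0} ∪
        Metric.ball (0 : Space n) 2 ∩ {x | 0 < u (t, x) ∧ u (t, x) < 1})) := by
      refine measureReal_mono (fun x hx => ?_) (measure_union_ne_top
        ((measure_mono inter_subset_left).trans_lt measure_ball_lt_top).ne
        (measure_union_ne_top (hfinS _) (hfinS _)))
      rcases le_or_gt 1 (u (t, x)) with h1 | h1
      · exact Or.inl ⟨hx, h1⟩
      · rcases le_or_gt (u (t, x)) 0 with h0 | h0
        · exact Or.inr (Or.inl ⟨hb1 hx, h0⟩)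
        · exact Or.inr (Or.inr ⟨hb1 hx, h0, h1⟩)
    have e3 := (measureReal_union_le (μ := (volume : Measure (Space n))) _ _).trans'
      e2
    have e4 := measureReal_union_le (μ := (volume : Measure (Space n)))
      (Metric.ball (0 : Space n) 2 ∩ {x | u (t, x) ≤ 0})
      (Metric.ball (0 : Space n) 2 ∩ {x | 0 < u (t, x) ∧ u (t, x) < 1})
    linarith
  · intro s t has hst htb hstτ
    have g1 := h₂ a b u f G F h s t has hst htb
    have g2 := integral_abs_le hm hη0.le hY₂' h.continuous_f hfK has hst htb
    have g3 : 0 ≤ ∫ r in Ioc s t, ∫ x in Metric.closedBall (0 : Space n) (5 / 2),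
        dissip k p ξ₂ u G (r, x) :=
      integral_nonneg fun r => integral_nonneg fun x => mul_nonneg (mul_nonneg (mul_nonneg
            (by positivity) (posPow_nonneg _ _)) (sq_nonneg _)) (Real.rpow_nonneg (h.nonneg_G _) _)
    have g4 : 0 ≤ c / 2 * ∫ r in Ioc s t, ∫ x in Metric.closedBall (0 : Space n) (5 / 2),
        dissip k p ξ₂ u G (r, x) := by positivity
    have g5 := mul_le_mul_of_nonneg_left g2 hC₂.le
    have g6 : (C₂ + C₂ * Y₂ * V') * (t - s) ≤ v₁ / 4 := by
      have : t - s ≤ v₁ / (4 * (C₂ + C₂ * Y₂ * V')) := hstτ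
      rw [le_div_iff₀ (by positivity)] at this
      linarith
    have g7 : C₂ * (η * K) ≤ v₁ / 8 := by
      have : η * (8 * C₂ * (K + 1)) = v₁ := by rw [hη]; field_simp
      have : 0 ≤ C₂ * η := by positivity
      linarith
    linarith
  · have i0 : IntegrableOn (fun t => volume.real (Prod.mk t ⁻¹' SC)) (Icc a b) :=
      Measure.integrableOn_of_bounded (M := V) (by simp)
        (measurable_volume_section hSCm).aestronglyMeasurable
        (Filter.Eventually.of_forall fun t => by
          rw [Real.norm_of_nonneg measureReal_nonneg]; exact hleV t _)
    have iAB : IntegrableOn (fun t => volume.real (Prod.mk t ⁻¹' SA)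
        * volume.real (Prod.mk t ⁻¹' SB)) (Icc a b) :=
      Measure.integrableOn_of_bounded (M := V * V) (by simp)
        ((measurable_volume_section hSAm).mul
          (measurable_volume_section hSBm)).aestronglyMeasurable
        (Filter.Eventually.of_forall fun t => by
          rw [Real.norm_of_nonneg (mul_nonneg measureReal_nonneg measureReal_nonneg)]
          exact mul_le_mul (hleV t _) (hleV t _) measureReal_nonneg hV0.le)
    have iD' : IntegrableOn (fun t => ∫ x in Metric.closedBall (0 : Space n) (5 / 2),
        dissip k p ξ₁ u G (t, x)) (Icc a b) := by
      rwa [integrableOn_Icc_iff_integrableOn_Ioc]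
    have hCint : ∫ t in Icc a b, volume.real (Prod.mk t ⁻¹' SC) ≤ κ := by
      rw [integral_volume_section hSCm (fun t => hfin t _), hSC, hsec]
      exact hlt.le
    calc _ ≤ ∫ t in Icc a b, P * (2 * d * (∫ x in Metric.closedBall (0 : Space n) (5 / 2),
          dissip k p ξ₁ u G (t, x)) + 2 * (k + 3) * Y₃ * volume.real (Prod.mk t ⁻¹' SC)) := by
          refine setIntegral_mono_on iAB
            (((iD'.const_mul _).add (i0.const_mul _)).const_mul _) measurableSet_Icc fun t ht => ?_
          simp only [secA, secB, secC]
          exact slice_isoperimetric (by linarith) h hd0.le hY₃.le hY₃' k rfl ht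
      _ = P * (2 * d * (∫ t in Icc a b, ∫ x in Metric.closedBall (0 : Space n) (5 / 2),
          dissip k p ξ₁ u G (t, x)) + 2 * (k + 3) * Y₃ *
            ∫ t in Icc a b, volume.real (Prod.mk t ⁻¹' SC)) := by
          rw [integral_const_mul, integral_add (iD'.const_mul _) (i0.const_mul _),
            integral_const_mul, integral_const_mul]
      _ ≤ P * (2 * d * E₀ + 2 * (k + 3) * Y₃ * κ) := by
          rw [integral_Icc_eq_integral_Ioc (f := fun t =>
            ∫ x in Metric.closedBall (0 : Space n) (5 / 2), dissip k p ξ₁ u G (t, x))]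
          gcongr
      _ ≤ κ' := by linarith
  · rw [integral_volume_section hSCm (fun t => hfin t _), hSC, hsec]
    exact hlt.le
  · rw [integral_volume_section hSAm (fun t => hfin t _), hSA, hsec]
    exact hu0
  · rw [integral_volume_section hSBm (fun t => hfin t _), hSB, hsec]
    exact hu1

/-! ### Rescaling and mollification -/

instance : (volume : Measure (ℝ × Space n)).IsAddHaarMeasure :=
  inferInstanceAs ((volume : Measure ℝ).prod (volume : Measure (Space n))).IsAddHaarMeasure

/-- The change 3u - 1 maps the levels 1/3 and 2/3 to 0 and 1, leaving a margin of 1/3 around the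
original levels. The factor 3^(-p) compensates the homogeneity of the gradient term. -/
lemma IsClassicalSubsolution.rescale {c Λ M p a b : ℝ} {u f G : ℝ × Space n → ℝ}
    {F : ℝ × Space n → Space n} (h : IsClassicalSubsolution c Λ M p a b u f G F) :
    IsClassicalSubsolution (3 * c * (3 ^ p)⁻¹) Λ (3 * M - 1) p a b (fun z => 3 * u z - 1)
      (fun z => 3 * f z) (fun z => 3 * G z) (fun z => (3 : ℝ) • F z) := by
  have hu := h.contDiff_u
  have hF := h.contDiff_F
  have hf := h.continuous_f
  have hG := h.continuous_G
  have du : ∀ z, fderiv ℝ (fun z => 3 * u z - 1) z = (3 : ℝ) • fderiv ℝ u z := fun z =>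
    (((hu.differentiable one_ne_zero z).hasFDerivAt.const_mul 3).sub_const 1).fderiv
  have dF : ∀ z, fderiv ℝ (fun z => (3 : ℝ) • F z) z = (3 : ℝ) • fderiv ℝ F z := fun z =>
    ((hF.differentiable one_ne_zero z).hasFDerivAt.const_smul (3 : ℝ)).fderiv
  refine ⟨by fun_prop, by fun_prop, by fun_prop, by fun_prop,
    fun z => mul_nonneg (by norm_num) (h.nonneg_G z), fun z hz => by linarith [h.le z hz],
    fun z hz v => ?_, fun z hz => ?_, fun z hz => ?_⟩
  · have := h.grad_le z hz v
    rw [du, smul_apply, smul_eq_mul, abs_mul, abs_of_pos (by norm_num : (0 : ℝ) < 3)]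
    linarith
  · have := h.flux_le z hz
    rw [norm_smul, Real.norm_of_nonneg (by norm_num : (0 : ℝ) ≤ 3)]
    linarith
  · have := h.subsol z hz
    have e1 : spaceDiv (fun z => (3 : ℝ) • F z) z = 3 * spaceDiv F z := by
      simp [spaceDiv, dF, Finset.mul_sum]
    rw [du, e1, smul_apply, smul_eq_mul, Real.mul_rpow (by norm_num) (h.nonneg_G z)]
    have h3 : (3 : ℝ) ^ p ≠ 0 := by positivity
    have e2 : 3 * c * (3 ^ p)⁻¹ * (3 ^ p * G z ^ p) = 3 * (c * G z ^ p) := by field_simp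
    rw [e2]
    linarith

section Mollify

variable {X : Type*} [NormedAddCommGroup X] [NormedSpace ℝ X]

/-- Mollification of the restriction of `k` to `U`. -/
noncomputable def mollify (ρ : ContDiffBump (0 : ℝ × Space n)) (U : Set (ℝ × Space n))
    (k : ℝ × Space n → X) : ℝ × Space n → X :=
  convolution (ρ.normed volume) (U.indicator k) (ContinuousLinearMap.lsmul ℝ ℝ) volume

variable {ρ : ContDiffBump (0 : ℝ × Space n)} {U : Set (ℝ × Space n)} {k : ℝ × Space n → X}

lemma integrableOn_kernel {φ : ℝ × Space n → ℝ} (hφ : Continuous φ) (hc : HasCompactSupport φ)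
    (hU : MeasurableSet U) (hk : IntegrableOn k U) (z : ℝ × Space n) :
    IntegrableOn (fun w => φ (z - w) • k w) U := by
  have h := ((hc.convolutionExists_left (ContinuousLinearMap.lsmul ℝ ℝ) hφ
    (hk.integrable_indicator hU).locallyIntegrable) z).integrable_swap
  have e : (fun w => (ContinuousLinearMap.lsmul ℝ ℝ (φ (z - w))) (U.indicator k w))
      = U.indicator fun w => φ (z - w) • k w := by
    ext w; by_cases hw : w ∈ U <;> simp [hw]
  rw [e] at h
  exact (integrable_indicator_iff hU).1 h

lemma mollify_eq (hU : MeasurableSet U) (z : ℝ × Space n) :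
    mollify ρ U k z = ∫ w in U, ρ.normed volume (z - w) • k w := by
  rw [mollify, convolution_eq_swap, ← integral_indicator hU]
  refine integral_congr_ae (Filter.Eventually.of_forall fun w => ?_)
  by_cases hw : w ∈ U <;> simp [hw]

lemma contDiff_mollify (hU : MeasurableSet U) (hk : IntegrableOn k U) :
    ContDiff ℝ 1 (mollify ρ U k) :=
  ρ.hasCompactSupport_normed.contDiff_convolution_left _ (n := 1) ρ.contDiff_normed
    (hk.integrable_indicator hU).locallyIntegrable

lemma fderiv_mollify [CompleteSpace X] (hU : MeasurableSet U) (hk : IntegrableOn k U)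
    (z v : ℝ × Space n) :
    fderiv ℝ (mollify ρ U k) z v = ∫ w in U, fderiv ℝ (ρ.normed volume) (z - w) v • k w := by
  have hφ : ContDiff ℝ 1 (ρ.normed volume) := ρ.contDiff_normed (n := 1)
  have hloc := (hk.integrable_indicator hU).locallyIntegrable
  have hc : HasCompactSupport (ρ.normed volume) := ρ.hasCompactSupport_normed
  have h := (hc.hasFDerivAt_convolution_left (ContinuousLinearMap.lsmul ℝ ℝ) hφ hloc z).fderiv
  have hi := ((hc.fderiv ℝ).convolutionExists_left
    (ContinuousLinearMap.precompL (ℝ × Space n) (ContinuousLinearMap.lsmul ℝ ℝ))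
    (hφ.continuous_fderiv one_ne_zero) hloc z).integrable_swap
  rw [mollify, h, convolution_eq_swap, ContinuousLinearMap.integral_apply hi,
    ← integral_indicator hU]
  refine integral_congr_ae (Filter.Eventually.of_forall fun w => ?_)
  by_cases hw : w ∈ U <;> simp [hw]

lemma norm_mollify_le (hU : MeasurableSet U) (z : ℝ × Space n) :
    ‖mollify ρ U k z‖ ≤ mollify ρ U (fun w => ‖k w‖) z := by
  rw [mollify_eq hU, mollify_eq hU]
  refine (norm_integral_le_integral_norm _).trans (le_of_eq ?_)
  refine integral_congr_ae (Filter.Eventually.of_forall fun w => ?_)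
  simp only [norm_smul, smul_eq_mul, Real.norm_of_nonneg (ρ.nonneg_normed _)]

lemma mollify_mono (hU : MeasurableSet U) {k₁ k₂ : ℝ × Space n → ℝ} (h₁ : IntegrableOn k₁ U)
    (h₂ : IntegrableOn k₂ U) (h : ∀ᵐ z ∂(volume.restrict U), k₁ z ≤ k₂ z) (z : ℝ × Space n) :
    mollify ρ U k₁ z ≤ mollify ρ U k₂ z := by
  rw [mollify_eq hU, mollify_eq hU]
  have hφ := (ρ.contDiff_normed (μ := volume) (n := 1)).continuous
  refine integral_mono_ae (integrableOn_kernel hφ ρ.hasCompactSupport_normed hU h₁ z)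
    (integrableOn_kernel hφ ρ.hasCompactSupport_normed hU h₂ z) ?_
  filter_upwards [h] with w hw
  exact smul_le_smul_of_nonneg_left hw (ρ.nonneg_normed _)

lemma mollify_nonneg (hU : MeasurableSet U) {k : ℝ × Space n → ℝ} (hk : ∀ z, 0 ≤ k z)
    (z : ℝ × Space n) : 0 ≤ mollify ρ U k z := by
  rw [mollify_eq hU]
  exact integral_nonneg fun w => smul_nonneg (ρ.nonneg_normed _) (hk w)

lemma mollify_const_mul (hU : MeasurableSet U) {k : ℝ × Space n → ℝ} (r : ℝ) (z : ℝ × Space n) :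
    mollify ρ U (fun w => r * k w) z = r * mollify ρ U k z := by
  rw [mollify_eq hU, mollify_eq hU, ← integral_const_mul]
  refine integral_congr_ae (Filter.Eventually.of_forall fun w => ?_)
  simp only [smul_eq_mul]; ring

lemma normed_sub_eq_zero {z w : ℝ × Space n} (hw : w ∉ Metric.closedBall z ρ.rOut) :
    ρ.normed volume (z - w) = 0 := by
  have : z - w ∉ tsupport (ρ.normed volume) := by
    rw [ρ.tsupport_normed_eq]
    simpa [dist_eq_norm, norm_sub_rev] using hw
  exact image_eq_zero_of_notMem_tsupport this

lemma setIntegral_normed_sub {z : ℝ × Space n}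
    (hz : Metric.closedBall z ρ.rOut ⊆ U) : ∫ w in U, ρ.normed volume (z - w) = 1 := by
  rw [setIntegral_eq_integral_of_forall_compl_eq_zero
    fun w hw => normed_sub_eq_zero fun h => hw (hz h),
    integral_sub_left_eq_self (ρ.normed volume) volume z, ρ.integral_normed]

lemma setIntegral_normed_sub_le_one (z : ℝ × Space n) :
    ∫ w in U, ρ.normed volume (z - w) ≤ 1 := by
  have h := integral_sub_left_eq_self (ρ.normed volume) volume z
  rw [ρ.integral_normed] at h
  rw [← h]
  refine setIntegral_le_integral ?_ (Filter.Eventually.of_forall fun w => ρ.nonneg_normed _)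
  exact ((ρ.contDiff_normed (μ := volume) (n := 1)).continuous.integrable_of_hasCompactSupport
    ρ.hasCompactSupport_normed).comp_sub_left z

/-- Jensen's inequality for mollification. -/
lemma mollify_rpow_le (hU : MeasurableSet U) {p : ℝ} (hp : 1 ≤ p) {k : ℝ × Space n → ℝ}
    (hk0 : ∀ z, 0 ≤ k z) (hk : IntegrableOn k U) (hkp : IntegrableOn (fun z => k z ^ p) U)
    (z : ℝ × Space n) :
    mollify ρ U k z ^ p ≤ mollify ρ U (fun w => k w ^ p) z := by
  have hφ := (ρ.contDiff_normed (μ := volume) (n := 1)).continuous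
  have hc : HasCompactSupport (ρ.normed volume) := ρ.hasCompactSupport_normed
  set G := mollify ρ U k z with hG
  have hG0 : 0 ≤ G := mollify_nonneg hU hk0 z
  rcases hG0.eq_or_lt with h0 | hpos
  · rw [← h0, Real.zero_rpow (by linarith)]
    exact mollify_nonneg hU (fun w => Real.rpow_nonneg (hk0 w) _) z
  -- The tangent line of y^p at G, obtained from Bernoulli's inequality. Its constant term is
  -- nonpositive, so a kernel of total mass at most 1 on U suffices after integration.
  have htan : ∀ y : ℝ, 0 ≤ y → p * G ^ (p - 1) * y - (p - 1) * G ^ p ≤ y ^ p := by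
    intro y hy
    have h1 := one_add_mul_self_le_rpow_one_add (s := y / G - 1)
      (by linarith [div_nonneg hy hpos.le]) hp
    rw [add_sub_cancel, Real.div_rpow hy hpos.le, le_div_iff₀ (by positivity)] at h1
    have h2 : G ^ p = G ^ (p - 1) * G := by rw [← Real.rpow_add_one hpos.ne']; ring_nf
    refine le_trans (le_of_eq ?_) h1
    rw [h2]
    field_simp
    ring
  rw [mollify_eq hU]
  have i1 := integrableOn_kernel hφ hc hU hkp z
  have i2 := integrableOn_kernel hφ hc hU hk z
  have i3 : IntegrableOn (fun w => ρ.normed volume (z - w)) U :=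
    ((hφ.integrable_of_hasCompactSupport hc).comp_sub_left z).integrableOn
  have i4 : IntegrableOn (fun w => p * G ^ (p - 1) * (ρ.normed volume (z - w) • k w)
    - (p - 1) * G ^ p * ρ.normed volume (z - w)) U := (i2.const_mul _).sub (i3.const_mul _)
  have h5 : ∫ w in U, (p * G ^ (p - 1) * (ρ.normed volume (z - w) • k w)
    - (p - 1) * G ^ p * ρ.normed volume (z - w)) ≤ ∫ w in U, ρ.normed volume (z - w) • k w ^ p := by
    refine integral_mono i4 i1 fun w => ?_
    have := mul_le_mul_of_nonneg_left (htan _ (hk0 w)) (ρ.nonneg_normed (μ := volume) (z - w))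
    simp only [smul_eq_mul]
    linarith
  refine le_trans ?_ h5
  rw [integral_sub (i2.const_mul _) (i3.const_mul _), integral_const_mul, integral_const_mul,
    ← mollify_eq hU, ← hG]
  have h6 := mul_le_mul_of_nonneg_left (setIntegral_normed_sub_le_one (ρ := ρ) (U := U) z)
    (show 0 ≤ (p - 1) * G ^ p from mul_nonneg (by linarith) (by positivity))
  have h7 : p * G ^ (p - 1) * G = p * G ^ p := by
    rw [mul_assoc, ← Real.rpow_add_one hpos.ne']; ring_nf
  rw [h7]
  linarith

/-- Mollification does not increase the `L^m` norm. -/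
lemma integral_abs_mollify_rpow_le (hU : MeasurableSet U) {m : ℝ} (hm : 1 ≤ m)
    {f : ℝ × Space n → ℝ} (hf : IntegrableOn f U) (hfm : IntegrableOn (fun z => |f z| ^ m) U)
    {S : Set (ℝ × Space n)} (hS : IsCompact S) :
    ∫ z in S, |mollify ρ U f z| ^ m ≤ ∫ z in U, |f z| ^ m := by
  have hi : Integrable (mollify ρ U fun z => |f z| ^ m) :=
    ((ρ.contDiff_normed (μ := volume) (n := 1)).continuous.integrable_of_hasCompactSupport
      ρ.hasCompactSupport_normed).integrable_convolution _ (hfm.integrable_indicator hU)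
  have hcont : Continuous (mollify ρ U f) := (contDiff_mollify hU hf).continuous
  calc ∫ z in S, |mollify ρ U f z| ^ m ≤ ∫ z in S, mollify ρ U (fun z => |f z| ^ m) z := by
        refine setIntegral_mono_on ?_ hi.integrableOn hS.measurableSet fun z _ => ?_
        · exact (hcont.abs.rpow_const fun _ =>
            Or.inr (by linarith)).continuousOn.integrableOn_compact hS
        · refine le_trans ?_ (mollify_rpow_le hU hm (fun z => abs_nonneg (f z)) hf.abs hfm z)
          exact Real.rpow_le_rpow (abs_nonneg _) (norm_mollify_le (k := f) hU z) (by linarith)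
    _ ≤ ∫ z, mollify ρ U (fun z => |f z| ^ m) z := setIntegral_le_integral hi
        (Filter.Eventually.of_forall fun z => mollify_nonneg hU (fun w => by positivity) z)
    _ = ∫ z in U, |f z| ^ m := by
        unfold mollify
        rw [integral_convolution _ ((ρ.contDiff_normed (μ := volume)
          (n := 1)).continuous.integrable_of_hasCompactSupport ρ.hasCompactSupport_normed)
          (hfm.integrable_indicator hU), ρ.integral_normed, integral_indicator hU]
        simp

end Mollify

/-! ### Mollified distributional subsolutions are classical -/

lemma isTestFunction_normed_sub {ρ : ContDiffBump (0 : ℝ × Space n)} {U : Set (ℝ × Space n)}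
    {z : ℝ × Space n} (hz : Metric.closedBall z ρ.rOut ⊆ U) :
    IsTestFunction U fun w => ρ.normed volume (z - w) := by
  have hsupp : tsupport (fun w => ρ.normed volume (z - w)) ⊆ Metric.closedBall z ρ.rOut := by
    refine closure_minimal (fun w hw => ?_) Metric.isClosed_closedBall
    by_contra h
    exact hw (normed_sub_eq_zero h)
  refine ⟨(ρ.contDiff_normed (n := ⊤)).comp (contDiff_const.sub contDiff_id), ?_, hsupp.trans hz⟩
  exact (isCompact_closedBall z ρ.rOut).of_isClosed_subset (isClosed_tsupport _) hsupp

lemma fderiv_normed_sub (ρ : ContDiffBump (0 : ℝ × Space n)) (z w v : ℝ × Space n) :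
    fderiv ℝ (fun w => ρ.normed volume (z - w)) w v = -fderiv ℝ (ρ.normed volume) (z - w) v := by
  have h1 := ((ρ.contDiff_normed (μ := volume) (n := 1)).differentiable one_ne_zero
    (z - w)).hasFDerivAt
  have h2 : HasFDerivAt (fun w => z - w) (-ContinuousLinearMap.id ℝ (ℝ × Space n)) w :=
    (hasFDerivAt_id w).const_sub z
  have h3 : HasFDerivAt (fun w => ρ.normed volume (z - w)) _ w := h1.comp w h2
  rw [h3.fderiv]
  simp

/-- All derivatives fall on the kernel, and summing over coordinates recombines them into one
derivative in the direction F w. Up to sign this is the flux term of the weak formulation tested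
with the kernel centred at z. -/
lemma spaceDiv_mollify {ρ : ContDiffBump (0 : ℝ × Space n)} {U : Set (ℝ × Space n)}
    (hU : MeasurableSet U) {F : ℝ × Space n → Space n} (hF : IntegrableOn F U)
    (z : ℝ × Space n) :
    spaceDiv (mollify ρ U F) z = ∫ w in U, fderiv ℝ (ρ.normed volume) (z - w) (0, F w) := by
  have hφ : ContDiff ℝ 1 (ρ.normed volume) := ρ.contDiff_normed (μ := volume) (n := 1)
  have hdφ := hφ.continuous_fderiv one_ne_zero
  have hc : HasCompactSupport (ρ.normed volume) := ρ.hasCompactSupport_normed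
  have hi : ∀ v : ℝ × Space n, IntegrableOn (fun w => fderiv ℝ (ρ.normed volume) (z - w) v • F w) U :=
    fun v => integrableOn_kernel (φ := fun z => fderiv ℝ (ρ.normed volume) z v) (by fun_prop)
      (hc.fderiv_apply ℝ v) hU hF z
  have hcoord : ∀ i, fderiv ℝ (mollify ρ U F) z (0, EuclideanSpace.single i 1) i
      = ∫ w in U, fderiv ℝ (ρ.normed volume) (z - w) (0, EuclideanSpace.single i 1) * F w i := by
    intro i
    rw [fderiv_mollify hU hF]
    have := (EuclideanSpace.proj (𝕜 := ℝ) i : Space n →L[ℝ] ℝ).integral_comp_comm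
      (hi (0, EuclideanSpace.single i 1))
    simpa using this.symm
  unfold spaceDiv
  simp_rw [hcoord]
  rw [← integral_finsetSum (f := fun i w =>
    fderiv ℝ (ρ.normed volume) (z - w) (0, EuclideanSpace.single i 1) * F w i) _ fun i _ => by
      have := (EuclideanSpace.proj (𝕜 := ℝ) i : Space n →L[ℝ] ℝ).integrable_comp
        (hi (0, EuclideanSpace.single i 1))
      simpa using this]
  refine integral_congr_ae (Filter.Eventually.of_forall fun w => ?_)
  have h := (EuclideanSpace.basisFun (Fin n) ℝ).sum_repr (F w)
  have h2 : fderiv ℝ (ρ.normed volume) (z - w) (0, F w) = ((fderiv ℝ (ρ.normed volume)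
      (z - w)).comp (ContinuousLinearMap.inr ℝ ℝ (Space n))) (F w) := by simp
  dsimp only
  rw [h2]
  conv_rhs => rw [← h]
  simp [map_sum, mul_comm]

lemma measurableSet_openCylinder (n : ℕ) (T r : ℝ) : MeasurableSet (openCylinder n T r) :=
  measurableSet_Ioo.prod Metric.isOpen_ball.measurableSet

/-- Mollifying a distributional subsolution yields a classical subsolution in the interior. -/
lemma isClassicalSubsolution_mollify {Λ p a b : ℝ} (hΛ : 0 < Λ) (hp : 1 ≤ p)
    {U : Set (ℝ × Space n)} (hU : MeasurableSet U) (hUf : volume U ≠ ⊤)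
    {ρ : ContDiffBump (0 : ℝ × Space n)} (hslab : ∀ z ∈ slab n a b, Metric.closedBall z ρ.rOut ⊆ U)
    {A : ℝ × Space n → Matrix (Fin n) (Fin n) ℝ} {f u : ℝ × Space n → ℝ}
    {g : ℝ × Space n → Space n} (hu : IntegrableOn u U) (hf : IntegrableOn f U)
    (hg : IntegrableOn g U) (hgp : IntegrableOn (fun z => ‖g z‖ ^ p) U)
    (hF : IntegrableOn (fun z => Matrix.toEuclideanCLM (n := Fin n) (𝕜 := ℝ) (A z) (g z)) U)
    (hFle : ∀ᵐ z ∂(volume.restrict U),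
      ‖Matrix.toEuclideanCLM (n := Fin n) (𝕜 := ℝ) (A z) (g z)‖ ≤ Λ * ‖g z‖)
    (hu2 : ∀ᵐ z ∂(volume.restrict U), u z ≤ 2) (hgrad : IsWeakGradient U u g)
    (hsub : IsSubsolution U Λ p A f u g) :
    IsClassicalSubsolution Λ⁻¹ Λ 2 p a b (mollify ρ U u) (mollify ρ U f)
      (mollify ρ U fun z => ‖g z‖)
      (mollify ρ U fun z => Matrix.toEuclideanCLM (n := Fin n) (𝕜 := ℝ) (A z) (g z)) := by
  set F : ℝ × Space n → Space n :=
    fun z => Matrix.toEuclideanCLM (n := Fin n) (𝕜 := ℝ) (A z) (g z) with hFdef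
  have hφ : ContDiff ℝ 1 (ρ.normed volume) := ρ.contDiff_normed (μ := volume) (n := 1)
  have hφc := hφ.continuous
  have hdφ := hφ.continuous_fderiv one_ne_zero
  have hc : HasCompactSupport (ρ.normed volume) := ρ.hasCompactSupport_normed
  have hgn : IntegrableOn (fun z => ‖g z‖) U := hg.norm
  refine ⟨contDiff_mollify hU hu, contDiff_mollify hU hF, (contDiff_mollify hU hf).continuous,
    (contDiff_mollify hU hgn).continuous, mollify_nonneg hU fun _ => norm_nonneg _, ?_, ?_, ?_, ?_⟩
  · intro z hz
    refine (mollify_mono hU hu (integrableOn_const hUf) hu2 z).trans (le_of_eq ?_)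
    simp only [mollify_eq hU, smul_eq_mul]
    rw [integral_mul_const, setIntegral_normed_sub (hslab z hz), one_mul]
  · intro z hz v
    have h := hgrad _ (isTestFunction_normed_sub (hslab z hz)) v
    have e : fderiv ℝ (mollify ρ U u) z (0, v)
        = ∫ w in U, inner ℝ (g w) v * ρ.normed volume (z - w) := by
      rw [fderiv_mollify hU hu, ← neg_eq_iff_eq_neg.2 h, ← integral_neg]
      refine integral_congr_ae (Filter.Eventually.of_forall fun w => ?_)
      simp only [spaceDeriv, fderiv_normed_sub, smul_eq_mul]
      ring
    rw [e, mollify_eq hU, ← integral_mul_const]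
    refine abs_integral_le_integral_abs.trans ?_
    refine integral_mono_of_nonneg (Filter.Eventually.of_forall fun w => abs_nonneg _)
      ((integrableOn_kernel hφc hc hU hgn z).mul_const _) (Filter.Eventually.of_forall fun w => ?_)
    have h1 := norm_inner_le_norm (𝕜 := ℝ) (g w) v
    have h2 := ρ.nonneg_normed (μ := volume) (z - w)
    rw [Real.norm_eq_abs] at h1
    simp only [abs_mul, abs_of_nonneg h2, smul_eq_mul]
    nlinarith
  · intro z _
    refine (norm_mollify_le (k := F) hU z).trans ?_
    rw [← mollify_const_mul hU]
    exact mollify_mono hU hF.norm (hgn.const_mul Λ) hFle z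
  · intro z hz
    have h := hsub _ (isTestFunction_normed_sub (hslab z hz)) fun w => ρ.nonneg_normed _
    have i1 : IntegrableOn (fun w => -(u w * timeDeriv (fun w => ρ.normed volume (z - w)) w)) U := by
      have := integrableOn_kernel (φ := fun z => fderiv ℝ (ρ.normed volume) z (1, 0)) (by fun_prop)
        (hc.fderiv_apply ℝ (1, 0)) hU hu z
      refine this.congr (Filter.Eventually.of_forall fun w => ?_)
      simp only [timeDeriv, fderiv_normed_sub, smul_eq_mul]
      ring
    have i2 : IntegrableOn (fun w => Λ⁻¹ * ‖g w‖ ^ p * ρ.normed volume (z - w)) U := by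
      refine ((integrableOn_kernel hφc hc hU hgp z).const_mul Λ⁻¹).congr
        (Filter.Eventually.of_forall fun w => ?_)
      simp only [smul_eq_mul]
      ring
    have i3 : IntegrableOn (fun w => spaceDeriv (fun w => ρ.normed volume (z - w)) w (F w)) U := by
      obtain ⟨C, hC⟩ := (hc.fderiv ℝ).exists_bound_of_continuous hdφ
      refine Integrable.mono' (hF.norm.const_mul C) ?_ (Filter.Eventually.of_forall fun w => ?_)
      · have : AEStronglyMeasurable (fun w => (fderiv ℝ (ρ.normed volume) (z - w)) (0, F w))
            (volume.restrict U) := by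
          exact (by fun_prop : Continuous fun q : (ℝ × Space n) × Space n =>
            fderiv ℝ (ρ.normed volume) (z - q.1) (0, q.2)).comp_aestronglyMeasurable
            (aestronglyMeasurable_id.prodMk hF.aestronglyMeasurable)
        refine this.neg.congr (Filter.Eventually.of_forall fun w => ?_)
        simp only [spaceDeriv, fderiv_normed_sub, Pi.neg_apply]
      · simp only [spaceDeriv, fderiv_normed_sub, norm_neg]
        refine ((fderiv ℝ (ρ.normed volume) (z - w)).le_opNorm _).trans ?_
        have : ‖((0 : ℝ), F w)‖ = ‖F w‖ := by simp [Prod.norm_def]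
        rw [this]
        exact mul_le_mul_of_nonneg_right (hC _) (norm_nonneg _)
    have i12 : IntegrableOn (fun w => -(u w * timeDeriv (fun w => ρ.normed volume (z - w)) w)
      + Λ⁻¹ * ‖g w‖ ^ p * ρ.normed volume (z - w)) U := i1.add i2
    rw [integral_add i12 i3, integral_add i1 i2] at h
    have e1 : ∫ w in U, -(u w * timeDeriv (fun w => ρ.normed volume (z - w)) w)
        = fderiv ℝ (mollify ρ U u) z (1, 0) := by
      rw [fderiv_mollify hU hu]
      refine integral_congr_ae (Filter.Eventually.of_forall fun w => ?_)
      simp only [timeDeriv, fderiv_normed_sub, smul_eq_mul]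
      ring
    have e2 : ∫ w in U, Λ⁻¹ * ‖g w‖ ^ p * ρ.normed volume (z - w)
        = Λ⁻¹ * mollify ρ U (fun w => ‖g w‖ ^ p) z := by
      rw [mollify_eq hU, ← integral_const_mul]
      refine integral_congr_ae (Filter.Eventually.of_forall fun w => ?_)
      simp only [smul_eq_mul]
      ring
    have e3 : ∫ w in U, spaceDeriv (fun w => ρ.normed volume (z - w)) w (F w)
        = -spaceDiv (mollify ρ U F) z := by
      rw [spaceDiv_mollify hU hF, ← integral_neg]
      refine integral_congr_ae (Filter.Eventually.of_forall fun w => ?_)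
      simp only [spaceDeriv, fderiv_normed_sub]
    have e4 : ∫ w in U, f w * ρ.normed volume (z - w) = mollify ρ U f z := by
      rw [mollify_eq hU]
      refine integral_congr_ae (Filter.Eventually.of_forall fun w => ?_)
      simp only [smul_eq_mul]
      ring
    rw [e1, e2, e3, e4] at h
    -- Jensen goes in the favourable direction: lowering the mollified |∇u|^p to G^p preserves the
    -- subsolution inequality.
    have hJ := mollify_rpow_le (ρ := ρ) hU hp (fun w => norm_nonneg (g w)) hgn hgp z
    have := mul_le_mul_of_nonneg_left hJ (inv_nonneg.2 hΛ.le)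
    linarith

/-! ### Transfer from mollified to distributional subsolutions -/

lemma openCylinder_subset_cylinder (n : ℕ) (T r : ℝ) : openCylinder n T r ⊆ cylinder n T r :=
  prod_mono Ioo_subset_Icc_self le_rfl

lemma volume_cylinder_lt_top (n : ℕ) (T r : ℝ) : volume (cylinder n T r) < ⊤ := by
  rw [cylinder, Measure.volume_eq_prod, Measure.prod_prod]
  exact ENNReal.mul_lt_top measure_Icc_lt_top measure_ball_lt_top

/-- The room is σ in time at each end and 3 - 5/2 = 1/2 in space. -/
lemma closedBall_subset_openCylinder {σ r : ℝ} (hrσ : r < σ) (hr : r < 1 / 2)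
    {z : ℝ × Space n} (hz : z ∈ slab n (-4 + σ) (-σ)) :
    Metric.closedBall z r ⊆ openCylinder n 4 3 := by
  intro w hw
  rw [Metric.mem_closedBall, Prod.dist_eq, max_le_iff, Real.dist_eq, abs_le] at hw
  have h1 : ‖z.2‖ ≤ 5 / 2 := by simpa using hz.2
  have h2 : ‖w.2‖ ≤ dist w.2 z.2 + ‖z.2‖ := by
    rw [dist_eq_norm]
    have := norm_add_le (w.2 - z.2) z.2
    rwa [sub_add_cancel] at this
  refine ⟨⟨by linarith [hw.1.1, hz.1.1], by linarith [hw.1.2, hz.1.2]⟩, ?_⟩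
  rw [mem_ball_zero_iff]
  linarith [hw.2]

/-- Mollification with a small parameter approximates `k` up to a set of small measure. -/
lemma exists_mollify_close {U S : Set (ℝ × Space n)} (hU : MeasurableSet U) {k : ℝ × Space n → ℝ}
    (hk : IntegrableOn k U) (hS : volume S < ⊤) {r₀ e η : ℝ} (hr₀ : 0 < r₀) (he : 0 < e)
    (hη : 0 < η) :
    ∃ ρ : ContDiffBump (0 : ℝ × Space n), ρ.rOut ≤ r₀ ∧
      volume.real ({z | e ≤ |mollify ρ U k z - U.indicator k z|} ∩ S) ≤ η := by
  -- The ratio of outer to inner radius is kept equal to 2, as the almost everywhere convergence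
  -- used below requires. Finiteness of the measure of S turns it into convergence in measure.
  let ρ : ℕ → ContDiffBump (0 : ℝ × Space n) := fun j =>
    ⟨r₀ / (j + 1) / 2, r₀ / (j + 1), by positivity, half_lt_self (by positivity)⟩
  have hρ : Filter.Tendsto (fun j => (ρ j).rOut) Filter.atTop (nhds 0) :=
    tendsto_const_div_atTop_nhds_zero_nat r₀ |>.comp (Filter.tendsto_add_atTop_nat 1) |>.congr
      fun j => by simp [ρ]
  have hi := hk.integrable_indicator hU
  have hae := ContDiffBump.ae_convolution_tendsto_right_of_locallyIntegrable (μ := volume) (K := 2)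
    hρ (Filter.Eventually.of_forall fun j => by simp only [ρ]; linarith) hi.locallyIntegrable
  have : IsFiniteMeasure (volume.restrict S) := ⟨by simpa using hS⟩
  have hmeas := tendstoInMeasure_of_tendsto_ae (μ := volume.restrict S)
    (f := fun j => mollify (ρ j) U k) (g := U.indicator k)
    (fun j => (contDiff_mollify hU hk).continuous.aestronglyMeasurable)
    (ae_restrict_of_ae hae)
  rw [tendstoInMeasure_iff_norm] at hmeas
  obtain ⟨j, hj⟩ := ((hmeas e he).eventually (gt_mem_nhds
    (show (0 : ENNReal) < ENNReal.ofReal η by simpa using hη))).exists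
  refine ⟨ρ j, ?_, ?_⟩
  · exact div_le_self hr₀.le (by linarith [Nat.cast_nonneg (α := ℝ) j])
  · have h1 : volume ({z | e ≤ |mollify (ρ j) U k z - U.indicator k z|} ∩ S) ≤ ENNReal.ofReal η :=
      (Measure.le_restrict_apply _ _).trans hj.le
    exact ENNReal.toReal_le_of_le_ofReal hη.le h1

/-- The intermediate value lemma for distributional subsolutions, in terms of integrability. -/
theorem exists_intermediate_measure_weak (n : ℕ) {Λ p m δ₀ : ℝ} (hΛ : 0 < Λ) (hp : 2 < p)
    (hm : 1 < m) (hδ₀ : 0 < δ₀) :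
    ∃ μ₀ : ℝ, 0 < μ₀ ∧
      ∀ (A : ℝ × Space n → Matrix (Fin n) (Fin n) ℝ) (f u : ℝ × Space n → ℝ)
        (g : ℝ × Space n → Space n),
        IntegrableOn u (openCylinder n 4 3) → IntegrableOn f (openCylinder n 4 3) →
        IntegrableOn g (openCylinder n 4 3) →
        IntegrableOn (fun z => ‖g z‖ ^ p) (openCylinder n 4 3) →
        IntegrableOn (fun z => |f z| ^ m) (openCylinder n 4 3) →
        IntegrableOn (fun z => Matrix.toEuclideanCLM (n := Fin n) (𝕜 := ℝ) (A z) (g z))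
          (openCylinder n 4 3) →
        ∫ z in openCylinder n 4 3, |f z| ^ m ≤ Λ ^ m →
        (∀ᵐ z ∂(volume.restrict (openCylinder n 4 3)),
          ‖Matrix.toEuclideanCLM (n := Fin n) (𝕜 := ℝ) (A z) (g z)‖ ≤ Λ * ‖g z‖) →
        (∀ᵐ z ∂(volume.restrict (openCylinder n 4 3)), u z ≤ 2) →
        IsWeakGradient (openCylinder n 4 3) u g → IsSubsolution (openCylinder n 4 3) Λ p A f u g →
        volume (cylinder n 4 2) / 2 ≤ volume ({z | u z ≤ 0} ∩ cylinder n 4 2) →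
        ENNReal.ofReal δ₀ ≤ volume ({z | 1 ≤ u z} ∩ cylinder n 2 2) →
        ENNReal.ofReal μ₀ ≤ volume ({z | 0 < u z ∧ u z < 1} ∩ cylinder n 4 2) := by
  -- The parameters are those of 3u - 1. As κ is fixed before u is given, the mollifier may depend
  -- on u while the final constant does not.
  obtain ⟨κ, hκ, H⟩ := exists_intermediate_measure n (c := 3 * Λ⁻¹ * (3 ^ p)⁻¹) (Λ := Λ)
    (M := 3 * 2 - 1) (K := 3 ^ m * Λ ^ m) hp hm (by positivity) hΛ (by norm_num) (by positivity)
    hδ₀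
  refine ⟨κ / 2, by positivity, ?_⟩
  intro A f u g iu if' ig igp ifm iF hfK hFle hu2 hgrad hsub hu0 hu1
  set U := openCylinder n 4 3 with hUdef
  have hU : MeasurableSet U := measurableSet_openCylinder n 4 3
  have hUfin : volume U < ⊤ := (measure_mono (openCylinder_subset_cylinder n 4 3)).trans_lt
    (volume_cylinder_lt_top n 4 3)
  set V := volume.real (Metric.ball (0 : Space n) 2) with hV
  have hV0 : 0 ≤ V := measureReal_nonneg
  -- The two time strips lost at the ends have total measure 2σV ≤ κ/4. The bad set of the
  -- mollification costs another κ/4.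
  set σ : ℝ := min 1 (κ / (8 * (V + 1))) with hσ
  have hσ0 : 0 < σ := by positivity
  have hσ1 : σ ≤ 1 := min_le_left _ _
  have hσV : 2 * σ * V ≤ κ / 4 := by
    have : σ ≤ κ / (8 * (V + 1)) := min_le_right _ _
    rw [le_div_iff₀ (by positivity)] at this
    linarith
  set Q := cylinder n 4 2 with hQ
  have hQ2fin : volume Q < ⊤ := volume_cylinder_lt_top n 4 2
  obtain ⟨ρ, hρ, hbad⟩ := exists_mollify_close (e := 1 / 3) (η := κ / 4) (r₀ := σ / 3) hU iu
    hQ2fin (by positivity) (by norm_num) (by positivity)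
  set Bad : Set (ℝ × Space n) :=
    {z | 1 / 3 ≤ |mollify ρ U u z - U.indicator u z|} ∩ Q with hBad
  have hcl := (isClassicalSubsolution_mollify (ρ := ρ) (a := -4 + σ) (b := -σ) hΛ
    (show 1 ≤ p by linarith) hU hUfin.ne
    (fun z hz => closedBall_subset_openCylinder (by linarith) (by linarith) hz) iu if' ig igp
    iF hFle hu2 hgrad hsub).rescale
  set S : Set (ℝ × Space n) := Icc (-4 + σ) (-σ) ×ˢ Metric.ball 0 2 with hS
  have hSQ : S ⊆ Q := prod_mono (Icc_subset_Icc (by linarith) (by linarith)) le_rfl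
  have hSU : S ⊆ U := prod_mono (fun t ht => ⟨by linarith [ht.1], by linarith [ht.2]⟩)
    (Metric.ball_subset_ball (by norm_num))
  have hstrip : volume.real (Q \ S) ≤ κ / 4 := by
    have hsub' : Q \ S ⊆ (Icc (-4) (-4 + σ) ×ˢ Metric.ball (0 : Space n) 2)
        ∪ (Icc (-σ) 0 ×ˢ Metric.ball (0 : Space n) 2) := by
      rintro z ⟨hzQ, hzS⟩
      by_cases h1 : z.1 ≤ -4 + σ
      · exact Or.inl ⟨⟨hzQ.1.1, h1⟩, hzQ.2⟩
      by_cases h2 : -σ ≤ z.1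
      · exact Or.inr ⟨⟨h2, hzQ.1.2⟩, hzQ.2⟩
      · exact absurd ⟨⟨(not_le.1 h1).le, (not_le.1 h2).le⟩, hzQ.2⟩ hzS
    have hfin : ∀ c d : ℝ, volume (Icc c d ×ˢ Metric.ball (0 : Space n) 2) ≠ ⊤ := fun c d => by
      rw [Measure.volume_eq_prod, Measure.prod_prod]
      exact (ENNReal.mul_lt_top measure_Icc_lt_top measure_ball_lt_top).ne
    refine (measureReal_mono hsub' (measure_union_ne_top (hfin _ _) (hfin _ _))).trans
      ((measureReal_union_le _ _).trans ?_)
    rw [Measure.volume_eq_prod, measureReal_prod_prod, measureReal_prod_prod,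
      Real.volume_real_Icc_of_le (by linarith), Real.volume_real_Icc_of_le (by linarith)]
    linarith
  have hclose : ∀ z ∈ S, z ∉ Bad → |mollify ρ U u z - u z| < 1 / 3 := fun z hz hzB => by
    by_contra h
    refine hzB ⟨?_, hSQ hz⟩
    show 1 / 3 ≤ |mollify ρ U u z - U.indicator u z|
    rw [indicator_of_mem (hSU hz)]
    exact not_lt.1 h
  have hfinQ : ∀ T : Set (ℝ × Space n), T ⊆ Q → volume T ≠ ⊤ := fun T hT =>
    ((measure_mono hT).trans_lt hQ2fin).ne
  have hfin3 : ∀ T : Set (ℝ × Space n), T ⊆ Q → volume (T ∪ (Bad ∪ Q \ S)) ≠ ⊤ := fun T hT =>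
    hfinQ _ (union_subset hT (union_subset inter_subset_right sdiff_subset))
  have hthree : ∀ T R : Set (ℝ × Space n), T ⊆ Q → R ⊆ T ∪ (Bad ∪ Q \ S) →
      volume.real R ≤ volume.real T + κ / 2 := fun T R hT hR => by
    have h1 := measureReal_mono hR (hfin3 T hT)
    have h2 := measureReal_union_le (μ := volume) T (Bad ∪ Q \ S)
    have h3 := measureReal_union_le (μ := volume) Bad (Q \ S)
    linarith
  have hmain := H (-4 + σ) (-σ) (by linarith) (by linarith) (by linarith) _ _ _ _ hcl ?_ ?_ ?_
  · have h1 : volume.real ({z | 0 < 3 * mollify ρ U u z - 1 ∧ 3 * mollify ρ U u z - 1 < 1} ∩ S)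
        ≤ volume.real ({z | 0 < u z ∧ u z < 1} ∩ Q) + κ / 2 := by
      refine hthree _ _ inter_subset_right ?_
      rintro z ⟨⟨hz1, hz2⟩, hzS⟩
      by_cases hB : z ∈ Bad
      · exact Or.inr (Or.inl hB)
      · have := abs_lt.1 (hclose z hzS hB)
        exact Or.inl ⟨⟨by linarith, by linarith⟩, hSQ hzS⟩
    rw [ENNReal.ofReal_le_iff_le_toReal (hfinQ _ inter_subset_right)]
    have h2 : κ / 2 ≤ volume.real ({z | 0 < u z ∧ u z < 1} ∩ Q) := by linarith
    exact h2
  · have e : ∀ z, |3 * mollify ρ U f z| ^ m = 3 ^ m * |mollify ρ U f z| ^ m := fun z => by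
      rw [abs_mul, abs_of_pos (by norm_num : (0 : ℝ) < 3), Real.mul_rpow (by norm_num)
        (abs_nonneg _)]
    simp_rw [e]
    rw [integral_const_mul]
    refine mul_le_mul_of_nonneg_left ((integral_abs_mollify_rpow_le hU hm.le if' ifm
      (isCompact_Icc.prod (isCompact_closedBall _ _))).trans hfK) (by positivity)
  · have h1 : volume.real ({z | u z ≤ 0} ∩ Q)
        ≤ volume.real ({z | 3 * mollify ρ U u z - 1 ≤ 0} ∩ S) + κ / 2 := by
      refine hthree _ _ (inter_subset_right.trans hSQ) ?_
      rintro z ⟨hz, hzQ⟩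
      by_cases hB : z ∈ Bad
      · exact Or.inr (Or.inl hB)
      by_cases hzS : z ∈ S
      · have := abs_lt.1 (hclose z hzS hB)
        have hz' : u z ≤ 0 := hz
        exact Or.inl ⟨show 3 * mollify ρ U u z - 1 ≤ 0 by linarith, hzS⟩
      · exact Or.inr (Or.inr ⟨hzQ, hzS⟩)
    have h2 := ENNReal.toReal_mono (hfinQ _ inter_subset_right) hu0
    rw [ENNReal.toReal_div] at h2
    have h3 : (volume Q).toReal = 4 * V := by
      change volume.real Q = _
      rw [hQ, cylinder, Measure.volume_eq_prod, measureReal_prod_prod,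
        Real.volume_real_Icc_of_le (by norm_num)]
      norm_num [hV]
    rw [h3] at h2
    have h4 : 2 * V ≤ volume.real ({z | u z ≤ 0} ∩ Q) := by
      refine le_trans (le_of_eq ?_) h2
      norm_num; ring
    linarith
  · have h1 : volume.real ({z | 1 ≤ u z} ∩ cylinder n 2 2)
        ≤ volume.real ({z | 1 ≤ 3 * mollify ρ U u z - 1}
          ∩ Icc (max (-4 + σ) (-2)) (-σ) ×ˢ Metric.ball (0 : Space n) 2) + κ / 2 := by
      refine hthree _ _ (inter_subset_right.trans ((prod_mono (Icc_subset_Icc_left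
        (le_max_left _ _)) le_rfl).trans hSQ)) ?_
      rintro z ⟨hz, hzQ⟩
      have hzQ4 : z ∈ Q := ⟨⟨by linarith [hzQ.1.1], hzQ.1.2⟩, hzQ.2⟩
      by_cases hB : z ∈ Bad
      · exact Or.inr (Or.inl hB)
      by_cases hzS : z ∈ S
      · have := abs_lt.1 (hclose z hzS hB)
        have hz' : 1 ≤ u z := hz
        exact Or.inl ⟨show 1 ≤ 3 * mollify ρ U u z - 1 by linarith,
          ⟨max_le hzS.1.1 hzQ.1.1, hzS.1.2⟩, hzQ.2⟩
      · exact Or.inr (Or.inr ⟨hzQ4, hzS⟩)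
    have hfin2 : volume ({z | 1 ≤ u z} ∩ cylinder n 2 2) ≠ ⊤ :=
      ((measure_mono inter_subset_right).trans_lt (volume_cylinder_lt_top n 2 2)).ne
    have h2 : δ₀ ≤ volume.real ({z | 1 ≤ u z} ∩ cylinder n 2 2) :=
      (ENNReal.ofReal_le_iff_le_toReal hfin2).1 hu1
    linarith

end HJ

/-! ### Reduction of the theorem to integrability statements on the open cylinder -/

theorem proposition4p1 (n : ℕ) (hn : 1 ≤ n) (Λ p m δ₀ : ℝ) (hΛ : 0 < Λ) (hp : 2 < p)
    (hm : 1 + max (n : ℝ) 2 / p < m) (hδ₀ : 0 < δ₀) :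
    ∃ μ₀ : ℝ, 0 < μ₀ ∧
      ∀ (A : ℝ × HJ.Space n → Matrix (Fin n) (Fin n) ℝ) (f u : ℝ × HJ.Space n → ℝ)
        (g : ℝ × HJ.Space n → HJ.Space n),
        -- `A ∈ L^∞(Q₃; ℝⁿˣⁿ)` with `‖A‖_∞ ≤ Λ` (Euclidean operator norm of matrices)
        MemLp (fun z => Matrix.toEuclideanCLM (n := Fin n) (𝕜 := ℝ) (A z)) ⊤
          (volume.restrict (HJ.cylinder n 4 3)) →
        eLpNorm (fun z => Matrix.toEuclideanCLM (n := Fin n) (𝕜 := ℝ) (A z)) ⊤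
          (volume.restrict (HJ.cylinder n 4 3)) ≤ ENNReal.ofReal Λ →
        -- `f ∈ L^m(Q₃)` with `‖f‖_m ≤ Λ`
        MemLp f (ENNReal.ofReal m) (volume.restrict (HJ.cylinder n 4 3)) →
        eLpNorm f (ENNReal.ofReal m) (volume.restrict (HJ.cylinder n 4 3)) ≤ ENNReal.ofReal Λ →
        -- `u ∈ L^p(-4, 0; W^{1,p}(B₃))` with `∇u = g`
        MemLp u (ENNReal.ofReal p) (volume.restrict (HJ.cylinder n 4 3)) →
        MemLp g (ENNReal.ofReal p) (volume.restrict (HJ.cylinder n 4 3)) →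
        HJ.IsWeakGradient (HJ.openCylinder n 4 3) u g →
        HJ.IsSubsolution (HJ.openCylinder n 4 3) Λ p A f u g →
        (∀ᵐ z ∂(volume.restrict (HJ.cylinder n 4 3)), u z ≤ 2) →
        volume (HJ.cylinder n 4 2) / 2 ≤ volume ({z | u z ≤ 0} ∩ HJ.cylinder n 4 2) →
        ENNReal.ofReal δ₀ ≤ volume ({z | 1 ≤ u z} ∩ HJ.cylinder n 2 2) →
        ENNReal.ofReal μ₀ ≤ volume ({z | 0 < u z ∧ u z < 1} ∩ HJ.cylinder n 4 2) := by
  have hm1 : 1 < m := by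
    have : 0 < max (n : ℝ) 2 / p := div_pos (lt_max_of_lt_right two_pos) (by linarith)
    linarith
  obtain ⟨μ₀, hμ₀, H⟩ := HJ.exists_intermediate_measure_weak n hΛ hp hm1 hδ₀
  refine ⟨μ₀, hμ₀, ?_⟩
  intro A f u g hA hAΛ hf hfΛ hu hg hgrad hsub hu2 hu0 hu1
  set U := HJ.openCylinder n 4 3 with hUdef
  have hU : MeasurableSet U := HJ.measurableSet_openCylinder n 4 3
  have hUQ : U ⊆ HJ.cylinder n 4 3 := HJ.openCylinder_subset_cylinder n 4 3
  have hQfin := HJ.volume_cylinder_lt_top n 4 3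
  have hUfin : volume U < ⊤ := (measure_mono hUQ).trans_lt hQfin
  have hle : volume.restrict U ≤ volume.restrict (HJ.cylinder n 4 3) :=
    Measure.restrict_mono hUQ le_rfl
  have : IsFiniteMeasure (volume.restrict U) := ⟨by simpa using hUfin⟩
  have hp1 : (1 : ENNReal) ≤ ENNReal.ofReal p := by
    rw [← ENNReal.ofReal_one]; exact ENNReal.ofReal_le_ofReal (by linarith)
  have hm1' : (1 : ENNReal) ≤ ENNReal.ofReal m := by
    rw [← ENNReal.ofReal_one]; exact ENNReal.ofReal_le_ofReal hm1.le
  have hp0 : ENNReal.ofReal p ≠ 0 := (zero_lt_one.trans_le hp1).ne'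
  have hm0 : ENNReal.ofReal m ≠ 0 := (zero_lt_one.trans_le hm1').ne'
  have hpR : (ENNReal.ofReal p).toReal = p := ENNReal.toReal_ofReal (by linarith)
  have hmR : (ENNReal.ofReal m).toReal = m := ENNReal.toReal_ofReal (by linarith)
  have iu : IntegrableOn u U := (hu.mono_measure hle).integrable hp1
  have ig : IntegrableOn g U := (hg.mono_measure hle).integrable hp1
  have if' : IntegrableOn f U := (hf.mono_measure hle).integrable hm1'
  have igp : IntegrableOn (fun z => ‖g z‖ ^ p) U := by
    have := (hg.mono_measure hle).integrable_norm_rpow hp0 ENNReal.ofReal_ne_top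
    rwa [hpR] at this
  have ifQ : IntegrableOn (fun z => |f z| ^ m) (HJ.cylinder n 4 3) := by
    have := hf.integrable_norm_rpow hm0 ENNReal.ofReal_ne_top
    rwa [hmR] at this
  have ifm : IntegrableOn (fun z => |f z| ^ m) U := ifQ.mono_set hUQ
  have hfK : ∫ z in U, |f z| ^ m ≤ Λ ^ m := by
    refine (setIntegral_mono_set ifQ (Filter.Eventually.of_forall fun z => by positivity)
      (Filter.Eventually.of_forall hUQ)).trans ?_
    rw [hf.eLpNorm_eq_integral_rpow_norm hm0 ENNReal.ofReal_ne_top, hmR,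
      ENNReal.ofReal_le_ofReal_iff hΛ.le] at hfΛ
    have h0 : 0 ≤ ∫ z in HJ.cylinder n 4 3, |f z| ^ m := integral_nonneg fun z => by positivity
    have h1 := Real.rpow_le_rpow (Real.rpow_nonneg h0 m⁻¹) hfΛ (show 0 ≤ m by linarith)
    rwa [← Real.rpow_mul h0, inv_mul_cancel₀ (by linarith), Real.rpow_one] at h1
  have hAle : ∀ᵐ z ∂(volume.restrict U),
      ‖Matrix.toEuclideanCLM (n := Fin n) (𝕜 := ℝ) (A z)‖ ≤ Λ := by
    refine ae_mono hle ?_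
    rw [eLpNorm_exponent_top] at hAΛ
    filter_upwards [ae_le_eLpNormEssSup (f := fun z =>
      Matrix.toEuclideanCLM (n := Fin n) (𝕜 := ℝ) (A z))
      (μ := volume.restrict (HJ.cylinder n 4 3))] with z hz
    have h1 := hz.trans hAΛ
    rwa [← ofReal_norm, ENNReal.ofReal_le_ofReal_iff hΛ.le] at h1
  have hFle : ∀ᵐ z ∂(volume.restrict U),
      ‖Matrix.toEuclideanCLM (n := Fin n) (𝕜 := ℝ) (A z) (g z)‖ ≤ Λ * ‖g z‖ := by
    filter_upwards [hAle] with z hz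
    exact (ContinuousLinearMap.le_opNorm _ _).trans
      (mul_le_mul_of_nonneg_right hz (norm_nonneg _))
  have iF : IntegrableOn (fun z => Matrix.toEuclideanCLM (n := Fin n) (𝕜 := ℝ) (A z) (g z)) U := by
    refine Integrable.mono' (ig.norm.const_mul Λ) ?_ hFle
    exact isBoundedBilinearMap_apply.continuous.comp_aestronglyMeasurable
      ((hA.mono_measure hle).aestronglyMeasurable.prodMk ig.aestronglyMeasurable)
  exact H A f u g iu if' ig igp ifm iF hfK hFle (ae_mono hle hu2) hgrad hsub hu0 hu1
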